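/- Let $k$ be a finite field with $q$ elements, let $K$ be a finite extension of the rational function field $k(t)$, and let $R$ be the integral closure of $k[t]$ in $K$. Let $E$ be the Carlitz module: for a $k[t]$-algebra $B$, $E(B)$ is the additive group of $B$ on which $k$ acts by multiplication and $t$ acts by $x\mapsto tx+x^q$. Let $\exp(Y)=\sum_{i\ge 0}e_iY^{q^i}\in k(t)[[Y]]$ be the unique power series of this form with $e_0=1$ and $t\exp(Y)+\exp(Y)^q=\exp(tY)$. Let $k((t^{-1}))^{\rm sep}$ be a separable closure of $k((t^{-1}))$, let $G$ be its Galois group over $k((t^{-1}))$, put $K_\infty^{\rm sep}=K\otimes_{k(t)}k((t^{-1}))^{\rm sep}$, and let $\Lambda_E\subset K_\infty^{\rm sep}$ be the kernel of $\exp$ on $K_\infty^{\rm sep}$. Let $U_R$ be the kernel of the connecting map $E(R)\to H^1(G,\Lambda_E)$ that sends $x=\exp(y)$, with $y\in K_\infty^{\rm sep}$, to the class of $\sigma\mapsto\sigma y-y$. Then the $k[t]$-module $U_R$ has rank $d-r$, where $d=[K:k(t)]$ and $r$ is the number of places $v$ of $K$ above $\infty$ such that $-t$ has a $(q-1)$-st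 root in the completion $K_v$. In particular, if $K$ is separable over $k(t)$, then $U_R$ has rank $d-r$ with $d$ the separable degree of $K$ over $k(t)$. For example, if $R=k[t]$, then $U_R$ has rank $1$ if $q>2$ and rank $0$ if $q=2$. -/

import Mathlib

open scoped Polynomial TensorProduct WithZero NNReal

namespace CarlitzUnits

noncomputable section

/-! ### The local field at infinity and its separable closure -/

/-- `k((1/t))`, the completion of `k(t)` at the place `∞`. -/
abbrev LaurentAtInfty (k : Type*) [Field k] : Type _ :=
  @RatFunc.CompletionAtInfty k _ (Classical.decEq (RatFunc k))

section LocalField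

variable (k : Type*) [Field k] [Fintype k]

instance : CompleteSpace (LaurentAtInfty k) := by
  let := Classical.decEq (RatFunc k)
  let := (RatFunc.inftyValued k).toUniformSpace
  exact UniformSpace.Completion.completeSpace (RatFunc k)

/-- The valuation at infinity is turned into an absolute value with `|t| = q`. -/
instance : Valuation.RankOne (Valued.v : Valuation (LaurentAtInfty k) ℤᵐ⁰) where
  hom' := (WithZeroMulInt.toNNReal (e := (Fintype.card k : ℝ≥0))
    (Nat.cast_ne_zero.mpr Fintype.card_ne_zero)).comp MonoidWithZeroHom.ValueGroup₀.embedding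
  strictMono' := (WithZeroMulInt.toNNReal_strictMono
    (Nat.one_lt_cast.mpr Fintype.one_lt_card)).comp
      MonoidWithZeroHom.ValueGroup₀.embedding_strictMono
  exists_val_nontrivial := by
    let := Classical.decEq (RatFunc k)
    refine ⟨algebraMap (RatFunc k) (LaurentAtInfty k) RatFunc.X, ?_⟩
    have h : Valued.v (algebraMap (RatFunc k) (LaurentAtInfty k) RatFunc.X) = WithZero.exp 1 := by
      let := RatFunc.inftyValued k
      rw [RatFunc.valuedCompletionAtInfty.def]
      refine (Valued.extensionValuation_apply_coe (RatFunc.X : RatFunc k)).trans ?_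
      exact RatFunc.inftyValuation.X k
    rw [h]
    exact ⟨WithZero.exp_ne_zero, by decide⟩

instance : NontriviallyNormedField (LaurentAtInfty k) :=
  Valued.toNontriviallyNormedField _ ℤᵐ⁰

instance : IsUltrametricDist (LaurentAtInfty k) := inferInstance

/-- A separable closure of `k((1/t))`. -/
abbrev LaurentSep (k : Type*) [Field k] : Type _ := SeparableClosure (LaurentAtInfty k)

/-- The unique extension of the absolute value at infinity. -/
instance : NontriviallyNormedField (LaurentSep k) :=
  spectralNorm.nontriviallyNormedField (LaurentAtInfty k) (LaurentSep k)

/-- The absolute Galois group of `k((1/t))`. -/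
abbrev GalInfty (k : Type*) [Field k] : Type _ := Gal(LaurentSep k/LaurentAtInfty k)

end LocalField

/-! ### Continuous cohomology in degree one with discrete coefficients -/

section H1

variable (G M : Type*) [Group G] [TopologicalSpace G] [AddCommGroup M] [DistribMulAction G M]

/-- Continuous 1-cocycles of `G` with values in the discrete `G`-module `M`. -/
def contCocycles₁ : AddSubgroup (G → M) where
  carrier := {f | IsLocallyConstant f ∧ ∀ g h, f (g * h) = g • f h + f g}
  zero_mem' := ⟨IsLocallyConstant.const 0, fun _ _ => by simp⟩
  add_mem' := by
    rintro a b ⟨ha, ha'⟩ ⟨hb, hb'⟩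
    refine ⟨ha.add hb, fun g h => ?_⟩
    simp only [Pi.add_apply, ha', hb', smul_add]
    abel
  neg_mem' := by
    rintro a ⟨ha, ha'⟩
    refine ⟨ha.neg, fun g h => ?_⟩
    simp only [Pi.neg_apply, ha', smul_neg]
    abel

/-- The cocycles of the form `g ↦ g m - m`. -/
def contCoboundaries₁ : AddSubgroup (contCocycles₁ G M) where
  carrier := {f | ∃ m : M, ∀ g, f.1 g = g • m - m}
  zero_mem' := ⟨0, fun _ => by simp⟩
  add_mem' := by
    rintro a b ⟨m, hm⟩ ⟨n, hn⟩
    refine ⟨m + n, fun g => ?_⟩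
    simp only [AddSubgroup.coe_add, Pi.add_apply, hm, hn, smul_add]
    abel
  neg_mem' := by
    rintro a ⟨m, hm⟩
    refine ⟨-m, fun g => ?_⟩
    simp only [AddSubgroup.coe_neg, Pi.neg_apply, hm, smul_neg]
    abel

/-- The group `H¹(G, M)`. -/
abbrev ContH1 : Type _ := contCocycles₁ G M ⧸ contCoboundaries₁ G M

end H1

/-! ### The Carlitz module -/

section Carlitz

variable (k : Type*) [Field k] [Fintype k]

/-- The endomorphism `x ↦ t x + x ^ q` of the additive group of a `k[t]`-algebra. -/
def carlitzEnd (B : Type*) [CommRing B] [Algebra k B] [Algebra k[X] B] : B →ₗ[k] B :=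
  LinearMap.mulLeft k (algebraMap k[X] B Polynomial.X) +
    (FiniteField.frobeniusAlgHom k B).toLinearMap

/-- The `k[t]`-module `E(B)` of `B`-rational points of the Carlitz module: the additive group of
`B`, on which `t` acts as `x ↦ t x + x ^ q`. -/
abbrev CarlitzPoints (B : Type*) [CommRing B] [Algebra k B] [Algebra k[X] B] : Type _ :=
  Module.AEval' (carlitzEnd k B)

/-- The coefficients of the Carlitz exponential `exp(Y) = ∑ i, e i * Y ^ (q ^ i)`. They are the
unique solution of `e 0 = 1` and `t * exp(Y) + exp(Y) ^ q = exp(t * Y)`, see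
`carlitzCoeff_functional`. -/
def carlitzCoeff : ℕ → RatFunc k
  | 0 => 1
  | i + 1 => carlitzCoeff i ^ Fintype.card k /
      (RatFunc.X ^ Fintype.card k ^ (i + 1) - RatFunc.X)

/-- Comparison of the coefficients of `Y ^ (q ^ (i + 1))` in `t * exp(Y) + exp(Y) ^ q` and in
`exp(t * Y)`. -/
theorem carlitzCoeff_functional (i : ℕ) :
    RatFunc.X * carlitzCoeff k (i + 1) + carlitzCoeff k i ^ Fintype.card k =
      carlitzCoeff k (i + 1) * RatFunc.X ^ Fintype.card k ^ (i + 1) := by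
  have h : (RatFunc.X ^ Fintype.card k ^ (i + 1) - RatFunc.X : RatFunc k) ≠ 0 := by
    rw [← RatFunc.algebraMap_X, ← map_pow, ← map_sub]
    refine RatFunc.algebraMap_ne_zero ?_
    exact FiniteField.X_pow_card_pow_sub_X_ne_zero k (Nat.succ_ne_zero i) Fintype.one_lt_card
  simp only [carlitzCoeff]
  field_simp
  ring

section Exponential

variable {k} {B : Type*} [CommRing B] [Algebra (RatFunc k) B]

theorem add_pow_card_pow (x y : B) (i : ℕ) :
    (x + y) ^ Fintype.card k ^ i = x ^ Fintype.card k ^ i + y ^ Fintype.card k ^ i := by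
  let := ((algebraMap (RatFunc k) B).comp (algebraMap k (RatFunc k))).toAlgebra
  have h : ∀ z : B, (FiniteField.frobeniusAlgHom k B)^[i] z = z ^ Fintype.card k ^ i := by
    intro z
    rw [FiniteField.coe_frobeniusAlgHom, pow_iterate]
  rw [← h, ← h, ← h, iterate_map_add]

theorem C_pow_card_pow (c : k) (i : ℕ) :
    algebraMap k (RatFunc k) c ^ Fintype.card k ^ i = algebraMap k (RatFunc k) c := by
  rw [← map_pow, FiniteField.pow_card_pow]

variable [TopologicalSpace B]

variable (k) in
/-- `IsCarlitzExp k y x` says that the exponential series of the Carlitz module converges at `y`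
and that its sum is `x`. -/
def IsCarlitzExp (y x : B) : Prop :=
  HasSum (fun i : ℕ => carlitzCoeff k i • y ^ Fintype.card k ^ i) x

namespace IsCarlitzExp

theorem zero : IsCarlitzExp k (0 : B) 0 := by
  unfold IsCarlitzExp
  have h : ∀ i : ℕ, Fintype.card k ^ i ≠ 0 := fun i => pow_ne_zero _ Fintype.card_ne_zero
  simp only [zero_pow (h _), smul_zero]
  exact hasSum_zero

theorem map {y x : B} (h : IsCarlitzExp k y x) (f : B →ₐ[RatFunc k] B) (hf : Continuous f) :
    IsCarlitzExp k (f y) (f x) := by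
  unfold IsCarlitzExp at *
  convert h.map f hf using 1
  funext i
  simp

variable [IsTopologicalRing B]

theorem add {y y' x x' : B} (h : IsCarlitzExp k y x)
    (h' : IsCarlitzExp k y' x') : IsCarlitzExp k (y + y') (x + x') := by
  unfold IsCarlitzExp at *
  simp only [add_pow_card_pow, smul_add]
  exact HasSum.add h h'

theorem const_smul {y x : B} (h : IsCarlitzExp k y x) (c : k) :
    IsCarlitzExp k (algebraMap k (RatFunc k) c • y) (algebraMap k (RatFunc k) c • x) := by
  unfold IsCarlitzExp at *
  simp only [smul_pow, C_pow_card_pow, smul_comm _ (algebraMap k (RatFunc k) c)]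
  simp only [Algebra.smul_def (algebraMap k (RatFunc k) c)]
  exact HasSum.mul_left _ h

theorem neg {y x : B} (h : IsCarlitzExp k y x) : IsCarlitzExp k (-y) (-x) := by
  have := h.const_smul (-1)
  rwa [map_neg, map_one, neg_one_smul, neg_one_smul] at this

theorem sub {y y' x x' : B} (h : IsCarlitzExp k y x)
    (h' : IsCarlitzExp k y' x') : IsCarlitzExp k (y - y') (x - x') := by
  rw [sub_eq_add_neg, sub_eq_add_neg]
  exact h.add h'.neg

theorem X_smul {y x : B} (h : IsCarlitzExp k y x) :
    IsCarlitzExp k ((RatFunc.X : RatFunc k) • y)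
      ((RatFunc.X : RatFunc k) • x + x ^ Fintype.card k) := by
  unfold IsCarlitzExp at *
  have h1 : HasSum (fun i : ℕ => (RatFunc.X : RatFunc k) • (carlitzCoeff k (i + 1) •
      y ^ Fintype.card k ^ (i + 1))) ((RatFunc.X : RatFunc k) • (x - y)) := by
    have := (hasSum_nat_add_iff' 1).mpr h
    simp only [Algebra.smul_def (RatFunc.X : RatFunc k)]
    refine HasSum.mul_left _ ?_
    simpa [carlitzCoeff] using this
  have h2 : HasSum (fun i : ℕ => (carlitzCoeff k i • y ^ Fintype.card k ^ i) ^ Fintype.card k)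
      (x ^ Fintype.card k) := by
    let F : B →+ B :=
      { toFun := fun z => z ^ Fintype.card k
        map_zero' := zero_pow Fintype.card_ne_zero
        map_add' := fun a b => by simpa using add_pow_card_pow (k := k) a b 1 }
    exact h.map F (continuous_pow _)
  rw [← hasSum_nat_add_iff' 1]
  have e0 : (RatFunc.X : RatFunc k) • x + x ^ Fintype.card k -
      ∑ i ∈ Finset.range 1, carlitzCoeff k i • ((RatFunc.X : RatFunc k) • y) ^ Fintype.card k ^ i =
      (RatFunc.X : RatFunc k) • (x - y) + x ^ Fintype.card k := by
    simp only [Finset.range_one, Finset.sum_singleton, pow_zero, pow_one, carlitzCoeff, one_smul,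
      smul_sub]
    abel
  have e1 : ∀ i : ℕ, carlitzCoeff k (i + 1) •
      ((RatFunc.X : RatFunc k) • y) ^ Fintype.card k ^ (i + 1) =
      (RatFunc.X : RatFunc k) • (carlitzCoeff k (i + 1) • y ^ Fintype.card k ^ (i + 1)) +
        (carlitzCoeff k i • y ^ Fintype.card k ^ i) ^ Fintype.card k := by
    intro i
    rw [smul_pow, smul_pow, smul_smul, smul_smul, ← carlitzCoeff_functional, ← pow_mul, ← pow_succ,
      add_smul]
  rw [e0, funext e1]
  exact h1.add h2

end IsCarlitzExp

end Exponential

end Carlitz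

/-! ### The exact sequence of the exponential and the module `U_R` -/

section Units

variable (k : Type*) [Field k] (K : Type*) [Field K] [Algebra (RatFunc k) K]

/-- `K_∞^sep`, the tensor product over `k(t)` of the separable closure of `k((1/t))` and `K`. -/
def KInftySep : Type _ := LaurentSep k ⊗[RatFunc k] K

instance : CommRing (KInftySep k K) := inferInstanceAs (CommRing (LaurentSep k ⊗[RatFunc k] K))

instance : Algebra (LaurentSep k) (KInftySep k K) :=
  inferInstanceAs (Algebra (LaurentSep k) (LaurentSep k ⊗[RatFunc k] K))

instance : Algebra (RatFunc k) (KInftySep k K) :=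
  inferInstanceAs (Algebra (RatFunc k) (LaurentSep k ⊗[RatFunc k] K))

instance : IsScalarTower (RatFunc k) (LaurentSep k) (KInftySep k K) :=
  inferInstanceAs (IsScalarTower (RatFunc k) (LaurentSep k) (LaurentSep k ⊗[RatFunc k] K))

instance [FunctionField k K] : Module.Finite (LaurentSep k) (KInftySep k K) :=
  inferInstanceAs (Module.Finite (LaurentSep k) (LaurentSep k ⊗[RatFunc k] K))

/-- The canonical map `K → K_∞^sep`. -/
def toKInftySep : K →ₐ[RatFunc k] KInftySep k K :=
  (Algebra.TensorProduct.includeRight : K →ₐ[RatFunc k] LaurentSep k ⊗[RatFunc k] K)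

/-- The action of the Galois group on `K_∞^sep` through the factor `k((1/t))^sep`. -/
def galoisMap (σ : GalInfty k) : KInftySep k K →ₐ[RatFunc k] KInftySep k K :=
  (Algebra.TensorProduct.map ((σ : LaurentSep k →ₐ[LaurentAtInfty k] LaurentSep k).restrictScalars
    (RatFunc k)) (AlgHom.id (RatFunc k) K) :
      LaurentSep k ⊗[RatFunc k] K →ₐ[RatFunc k] LaurentSep k ⊗[RatFunc k] K)

instance : SMul (GalInfty k) (KInftySep k K) := ⟨fun σ z => galoisMap k K σ z⟩

variable {k K}

theorem galois_smul_def (σ : GalInfty k) (z : KInftySep k K) : σ • z = galoisMap k K σ z := rfl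

@[elab_as_elim]
theorem KInftySep.induction {p : KInftySep k K → Prop} (z : KInftySep k K)
    (h : ∀ (a : LaurentSep k) (b : K), p (a • toKInftySep k K b))
    (hadd : ∀ x y, p x → p y → p (x + y)) : p z := by
  refine TensorProduct.induction_on (motive := p) z ?_ ?_ hadd
  · have := h 0 0
    rwa [zero_smul] at this
  · intro a b
    have := h a b
    have e : a • toKInftySep k K b = (a ⊗ₜ[RatFunc k] b : LaurentSep k ⊗[RatFunc k] K) := by
      change a • ((1 : LaurentSep k) ⊗ₜ[RatFunc k] b) = _
      rw [TensorProduct.smul_tmul', smul_eq_mul, mul_one]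
    rwa [e] at this

@[simp]
theorem galoisMap_toKInftySep (σ : GalInfty k) (x : K) :
    galoisMap k K σ (toKInftySep k K x) = toKInftySep k K x := by
  change Algebra.TensorProduct.map _ _ ((1 : LaurentSep k) ⊗ₜ[RatFunc k] x) = _
  rw [Algebra.TensorProduct.map_tmul, map_one]
  rfl

@[simp]
theorem galoisMap_algebraMap (σ : GalInfty k) (a : LaurentSep k) :
    galoisMap k K σ (algebraMap (LaurentSep k) _ a) = algebraMap (LaurentSep k) _ (σ a) := by
  change Algebra.TensorProduct.map _ _ (a ⊗ₜ[RatFunc k] (1 : K)) = _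
  rw [Algebra.TensorProduct.map_tmul, map_one]
  rfl

theorem galoisMap_smul (σ : GalInfty k) (a : LaurentSep k) (z : KInftySep k K) :
    galoisMap k K σ (a • z) = σ a • galoisMap k K σ z := by
  rw [Algebra.smul_def, map_mul, galoisMap_algebraMap, ← Algebra.smul_def]

instance : DistribMulAction (GalInfty k) (KInftySep k K) where
  one_smul z := by
    rw [galois_smul_def]
    induction z using KInftySep.induction with
    | h a b => rw [galoisMap_smul, galoisMap_toKInftySep, AlgEquiv.one_apply]
    | hadd x y hx hy => rw [map_add, hx, hy]
  mul_smul σ τ z := by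
    simp only [galois_smul_def]
    induction z using KInftySep.induction with
    | h a b => simp only [galoisMap_smul, galoisMap_toKInftySep, AlgEquiv.mul_apply]
    | hadd x y hx hy => simp only [map_add, hx, hy]
  smul_zero σ := map_zero (galoisMap k K σ)
  smul_add σ := map_add (galoisMap k K σ)

theorem isLocallyConstant_galois_smul (z : KInftySep k K) :
    IsLocallyConstant fun σ : GalInfty k => σ • z := by
  simp only [galois_smul_def]
  induction z using KInftySep.induction with
  | h a b =>
    simp only [galoisMap_smul, galoisMap_toKInftySep]
    refine IsLocallyConstant.comp (f := fun σ : GalInfty k => σ a) ?_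
      (fun c => c • toKInftySep k K b)
    rw [IsLocallyConstant.iff_exists_open]
    intro σ
    refine ⟨_, (stabilizer_isOpen_of_isIntegral (K := LaurentAtInfty k) a).leftCoset σ,
      ⟨1, one_mem _, mul_one σ⟩, ?_⟩
    rintro _ ⟨τ, hτ, rfl⟩
    change (σ * τ) a = σ a
    rw [AlgEquiv.mul_apply]
    exact congrArg σ hτ
  | hadd x y hx hy =>
    simp only [map_add]
    exact hx.add hy

variable [Fintype k]

/-- `K_∞^sep` has the topology of a finite free module over the normed field
`k((1/t))^sep`. -/
instance : TopologicalSpace (KInftySep k K) := moduleTopology (LaurentSep k) (KInftySep k K)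

instance : IsModuleTopology (LaurentSep k) (KInftySep k K) := ⟨rfl⟩

variable [FunctionField k K]

instance : IsTopologicalRing (KInftySep k K) :=
  IsModuleTopology.isTopologicalRing (LaurentSep k) (KInftySep k K)

theorem continuous_galoisMap (σ : GalInfty k) : Continuous (galoisMap k K σ) := by
  refine IsModuleTopology.continuous_of_ringHom (R := LaurentSep k)
    (galoisMap k K σ : KInftySep k K →+* KInftySep k K) ?_
  have h : Continuous (σ : LaurentSep k → LaurentSep k) := by
    have hσ : Isometry (σ : LaurentSep k → LaurentSep k) :=
      AddMonoidHomClass.isometry_of_norm σ fun z =>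
        (spectralNorm_eq_of_equiv (K := LaurentAtInfty k) σ z).symm
    exact hσ.continuous
  have h' : Continuous (algebraMap (LaurentSep k) (KInftySep k K)) :=
    IsModuleTopology.continuous_of_linearMap (Algebra.linearMap (LaurentSep k) (KInftySep k K))
  convert h'.comp h using 1
  funext a
  exact galoisMap_algebraMap σ a

variable (k K)

/-- `Λ_E`, the kernel of the exponential on `Lie(K_∞^sep)`. -/
def carlitzPeriods : AddSubgroup (KInftySep k K) where
  carrier := {y | IsCarlitzExp k y 0}
  zero_mem' := IsCarlitzExp.zero
  add_mem' := fun ha hb => by simpa using IsCarlitzExp.add ha hb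
  neg_mem' := fun ha => by simpa using IsCarlitzExp.neg ha

variable {k K}

theorem mem_carlitzPeriods {y : KInftySep k K} :
    y ∈ carlitzPeriods k K ↔ IsCarlitzExp k y 0 := Iff.rfl

theorem galois_smul_mem_carlitzPeriods (σ : GalInfty k) {y : KInftySep k K}
    (h : y ∈ carlitzPeriods k K) : σ • y ∈ carlitzPeriods k K := by
  have := IsCarlitzExp.map h (galoisMap k K σ) (continuous_galoisMap σ)
  rwa [map_zero] at this

instance : DistribMulAction (GalInfty k) (carlitzPeriods k K) where
  smul σ y := ⟨σ • y.1, galois_smul_mem_carlitzPeriods σ y.2⟩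
  one_smul y := Subtype.ext (one_smul _ y.1)
  mul_smul σ τ y := Subtype.ext (mul_smul σ τ y.1)
  smul_zero σ := Subtype.ext (smul_zero σ)
  smul_add σ y z := Subtype.ext (smul_add σ y.1 z.1)

@[simp]
theorem coe_galois_smul (σ : GalInfty k) (y : carlitzPeriods k K) :
    ((σ • y : carlitzPeriods k K) : KInftySep k K) = σ • (y : KInftySep k K) := rfl

theorem galois_smul_sub_mem {y : KInftySep k K} {x : K}
    (h : IsCarlitzExp k y (toKInftySep k K x)) (σ : GalInfty k) :
    σ • y - y ∈ carlitzPeriods k K := by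
  have h' := (h.map (galoisMap k K σ) (continuous_galoisMap σ)).sub h
  rwa [galoisMap_toKInftySep, sub_self] at h'

/-- The cocycle `σ ↦ σ y - y` attached to a point `y` of `Lie(K_∞^sep)` whose exponential is a
point of `E(K)`. -/
def connectingCocycle {y : KInftySep k K} {x : K} (h : IsCarlitzExp k y (toKInftySep k K x)) :
    contCocycles₁ (GalInfty k) (carlitzPeriods k K) :=
  ⟨fun σ => ⟨σ • y - y, galois_smul_sub_mem h σ⟩, by
    constructor
    · have : IsLocallyConstant fun σ : GalInfty k => σ • y - y :=
        (isLocallyConstant_galois_smul y).sub (IsLocallyConstant.const y)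
      exact IsLocallyConstant.desc _ Subtype.val this Subtype.val_injective
    · intro σ τ
      refine Subtype.ext ?_
      simp only [AddSubgroup.coe_add, coe_galois_smul, mul_smul, smul_sub]
      abel⟩

/-- The image in `H¹(G, Λ_E)` of the point `x = exp(y)` under the connecting homomorphism of
`0 → Λ_E → Lie(K_∞^sep) → E(K_∞^sep) → 0`. -/
def connectingClass {y : KInftySep k K} {x : K} (h : IsCarlitzExp k y (toKInftySep k K x)) :
    ContH1 (GalInfty k) (carlitzPeriods k K) :=
  QuotientAddGroup.mk (connectingCocycle h)

theorem connectingClass_eq_zero_iff {y : KInftySep k K} {x : K}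
    (h : IsCarlitzExp k y (toKInftySep k K x)) :
    connectingClass h = 0 ↔ ∃ l : KInftySep k K, IsCarlitzExp k l 0 ∧
      ∀ σ : GalInfty k, σ • y - y = σ • l - l := by
  unfold connectingClass
  rw [QuotientAddGroup.eq_zero_iff]
  constructor
  · rintro ⟨m, hm⟩
    exact ⟨m.1, m.2, fun σ => congrArg Subtype.val (hm σ)⟩
  · rintro ⟨l, hl, h'⟩
    exact ⟨⟨l, hl⟩, fun σ => Subtype.ext (h' σ)⟩

/-- The point `x` of `E(K)` lies in the kernel of the connecting homomorphism to `H¹(G, Λ_E)`. -/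
def InConnectingKernel (k : Type*) [Field k] [Fintype k] {K : Type*} [Field K]
    [Algebra (RatFunc k) K] [FunctionField k K] (x : K) : Prop :=
  ∃ (y : KInftySep k K) (h : IsCarlitzExp k y (toKInftySep k K x)), connectingClass h = 0

namespace InConnectingKernel

theorem iff_exists {x : K} : InConnectingKernel k x ↔
    ∃ y l : KInftySep k K, IsCarlitzExp k y (toKInftySep k K x) ∧ IsCarlitzExp k l 0 ∧
      ∀ σ : GalInfty k, galoisMap k K σ y - y = galoisMap k K σ l - l := by
  constructor
  · rintro ⟨y, h, h0⟩
    obtain ⟨l, hl⟩ := (connectingClass_eq_zero_iff h).mp h0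
    exact ⟨y, l, h, hl⟩
  · rintro ⟨y, l, h, hl⟩
    exact ⟨y, h, (connectingClass_eq_zero_iff h).mpr ⟨l, hl⟩⟩

theorem zero : InConnectingKernel k (0 : K) :=
  iff_exists.mpr ⟨0, 0, by simpa using IsCarlitzExp.zero, IsCarlitzExp.zero, fun _ => rfl⟩

theorem add {x x' : K} (h : InConnectingKernel k x) (h' : InConnectingKernel k x') :
    InConnectingKernel k (x + x') := by
  obtain ⟨y, l, hy, hl, e⟩ := iff_exists.mp h
  obtain ⟨y', l', hy', hl', e'⟩ := iff_exists.mp h'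
  refine iff_exists.mpr ⟨y + y', l + l', ?_, ?_, fun σ => ?_⟩
  · rw [map_add]
    exact hy.add hy'
  · simpa using hl.add hl'
  · rw [map_add, map_add, add_sub_add_comm, add_sub_add_comm, e, e']

theorem const_smul {x : K} (h : InConnectingKernel k x) (c : k) :
    InConnectingKernel k (algebraMap k (RatFunc k) c • x) := by
  obtain ⟨y, l, hy, hl, e⟩ := iff_exists.mp h
  refine iff_exists.mpr ⟨algebraMap k (RatFunc k) c • y, algebraMap k (RatFunc k) c • l,
    ?_, ?_, fun σ => ?_⟩
  · rw [map_smul]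
    exact hy.const_smul c
  · simpa using hl.const_smul c
  · rw [map_smul, map_smul, ← smul_sub, ← smul_sub, e]

theorem X_smul {x : K} (h : InConnectingKernel k x) :
    InConnectingKernel k ((RatFunc.X : RatFunc k) • x + x ^ Fintype.card k) := by
  obtain ⟨y, l, hy, hl, e⟩ := iff_exists.mp h
  refine iff_exists.mpr ⟨(RatFunc.X : RatFunc k) • y, (RatFunc.X : RatFunc k) • l,
    ?_, ?_, fun σ => ?_⟩
  · rw [map_add, map_smul, map_pow]
    exact hy.X_smul
  · simpa [zero_pow Fintype.card_ne_zero] using hl.X_smul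
  · rw [map_smul, map_smul, ← smul_sub, ← smul_sub, e]

end InConnectingKernel

variable (k K)
variable [Algebra k K] [Algebra k[X] K] [IsScalarTower k k[X] K] [IsScalarTower k[X] (RatFunc k) K]

/-- `U_R`, the kernel of `E(R) → H¹(G, Λ_E)`, where `R` is the integral closure of `k[t]`
in `K`. -/
def carlitzUnits : Submodule k[X] (CarlitzPoints k (FunctionField.ringOfIntegers k K)) where
  carrier := {x | InConnectingKernel k (((Module.AEval'.of _).symm x :
    FunctionField.ringOfIntegers k K) : K)}
  zero_mem' := by
    simpa using InConnectingKernel.zero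
  add_mem' := by
    intro a b ha hb
    simpa using InConnectingKernel.add ha hb
  smul_mem' := by
    have hX : ∀ x : CarlitzPoints k (FunctionField.ringOfIntegers k K),
        InConnectingKernel k (((Module.AEval'.of _).symm x :
          FunctionField.ringOfIntegers k K) : K) →
        InConnectingKernel k (((Module.AEval'.of _).symm ((Polynomial.X : k[X]) • x) :
          FunctionField.ringOfIntegers k K) : K) := by
      intro x hx
      rw [Module.AEval'.of_symm_X_smul]
      convert hx.X_smul using 1
      rw [Algebra.smul_def, ← RatFunc.algebraMap_X, ← IsScalarTower.algebraMap_apply]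
      rfl
    intro p x hx
    simp only [Set.mem_ofPred_eq] at hx ⊢
    induction p using Polynomial.induction_on with
    | C a =>
      rw [Module.AEval.C_smul, map_smul]
      have h : algebraMap (RatFunc k) K (algebraMap k (RatFunc k) a) = algebraMap k K a := by
        rw [IsScalarTower.algebraMap_apply k k[X] (RatFunc k),
          ← IsScalarTower.algebraMap_apply k[X] (RatFunc k) K,
          ← IsScalarTower.algebraMap_apply k k[X] K]
      convert hx.const_smul a using 1
      rw [Algebra.smul_def (algebraMap k (RatFunc k) a), h, ← Algebra.smul_def]
      rfl
    | add p q hp hq =>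
      rw [add_smul, map_add]
      exact hp.add hq
    | monomial n a ih =>
      rw [pow_succ', mul_left_comm, mul_smul]
      exact hX _ ih

end Units

/-! ### Places above infinity -/

section Places

variable (k : Type*) [Field k] [Fintype k] (K : Type*) [Field K] [Algebra (RatFunc k) K]

/-- The places of `K` above `∞`, given by their valuation rings: these are the valuation rings of
`K` that do not contain `t`. -/
def PlaceAboveInfty : Type _ :=
  {v : ValuationSubring K // algebraMap (RatFunc k) K RatFunc.X ∉ v}

variable {k K}

/-- The completion `K_v` of `K` at `v`. -/
abbrev PlaceAboveInfty.Completion (v : PlaceAboveInfty k K) : Type _ :=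
  v.1.valuation.Completion

/-- `-t` has a `(q - 1)`-st root in `K_v`. -/
def PlaceAboveInfty.HasRoot (v : PlaceAboveInfty k K) : Prop :=
  ∃ x : v.Completion, x ^ (Fintype.card k - 1) =
    -((algebraMap (RatFunc k) K RatFunc.X : K) : v.Completion)

end Places

end

end CarlitzUnits

/-!
Write `q = |k|`, `d = [K : k(t)]` and `K_∞ = k((1/t)) ⊗ K`. The Galois invariants of `K_∞^sep` are
`K_∞`, so an integral element `x` lies in `U_R` if and only if it is the exponential of an element
of `K_∞` (`inConnectingKernel_iff`). Hence `exp` induces an exact sequence `0 → Λ → M → U_R → 0`,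
where `M` is the `k[t]`-module of all `y` in `K_∞` with `exp y` in `R`, and `Λ` is the kernel of
`exp` on `K_∞`.

The rank of `M` is `d`: since `exp` maps small balls around `0` isometrically onto themselves and
`R` is discrete and cocompact in `K_∞`, so is `M` (`logLattice_fg_rank`). The rank of `Λ` is the
dimension over `k` of the space `T` of solutions of `τ ^ q = -t τ` in `K_∞`, because
`λ ↦ exp (λ / t)` induces an isomorphism from `Λ / t Λ` to `T` (`rank_torsion`). It is onto
because, for `τ` in `T` and `c` in `k((1/t))`, the exponential of `c τ` is `f c` times `τ` for a
power series `f` that takes the value `1`.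

It remains to show that the dimension of `T` is the number of places `v` above `∞` at which `-t` has
a `(q - 1)`-st root (`rank_torsion_eq_card_hasRoot`). Instead of decomposing `K_∞` as the product of
the completions `K_v`, the proof works with approximations in the dense subfield `K` of `K_∞`. They
can be compared with the places for two reasons: elements of `K` that are small in `K_∞` are small
at every `v` (`val_lt_one_of_norm_lt_one`), and elements that are small at every `v` are
topologically nilpotent in `K_∞` (`tendsto_ofK_pow`). An approximate root at a single place is made
small at the other places by weak approximation (`exists_approx`), and then corrected to a point of
`T` by a series that solves `t z + z ^ q = δ` for small `δ` (`exists_tendsto_approxRoot`). The same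
series, in `K_v`, shows that `-t` has a root in `K_v` if it has an approximate root in `K`
(`hasRoot_iff`). Conversely, an element `x` of `K` close to a point of `T` is at every place either
small or an approximate root, hence close to a multiple by a constant of a fixed approximate root,
and a point of `T` with an approximation that is small at all places is `0`
(`eq_zero_of_mem_torsion`).
-/

open scoped Polynomial TensorProduct WithZero NNReal

namespace CarlitzUnits

noncomputable section

/-! ### The absolute value of `k((1/t))` -/

section Local

theorem valued_algebraMap {k : Type*} [Field k] (f : RatFunc k) :
    Valued.v (algebraMap (RatFunc k) (LaurentAtInfty k) f) =
      @RatFunc.inftyValuationDef k _ (Classical.decEq _) f := by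
  let := Classical.decEq (RatFunc k)
  let := RatFunc.inftyValued k
  rw [RatFunc.valuedCompletionAtInfty.def]
  exact Valued.extensionValuation_apply_coe f

variable {k : Type*} [Field k] [Fintype k]

theorem one_lt_card : (1 : ℝ) < Fintype.card k := by exact_mod_cast Fintype.one_lt_card

theorem card_pos : (0 : ℝ) < Fintype.card k := zero_lt_one.trans one_lt_card

theorem norm_algebraMap {f : RatFunc k} (hf : f ≠ 0) :
    ‖algebraMap (RatFunc k) (LaurentAtInfty k) f‖ = (Fintype.card k : ℝ) ^ f.intDegree := by
  have h := valued_algebraMap f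
  rw [RatFunc.inftyValuationDef, if_neg hf] at h
  rw [Valued.toNormedField.norm_def]
  change ((WithZeroMulInt.toNNReal (e := (Fintype.card k : ℝ≥0))
    (Nat.cast_ne_zero.mpr Fintype.card_ne_zero) (MonoidWithZeroHom.ValueGroup₀.embedding _) :
      ℝ≥0) : ℝ) = _
  rw [Valuation.embedding_restrict, h, WithZeroMulInt.toNNReal_neg_apply _ WithZero.exp_ne_zero]
  push_cast
  rfl

theorem norm_algebraMap_X :
    ‖algebraMap (RatFunc k) (LaurentAtInfty k) RatFunc.X‖ = Fintype.card k := by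
  rw [norm_algebraMap RatFunc.X_ne_zero, RatFunc.intDegree_X, zpow_one]

theorem norm_algebraMap_polynomial {p : k[X]} (hp : p ≠ 0) :
    ‖algebraMap (RatFunc k) (LaurentAtInfty k) (algebraMap k[X] (RatFunc k) p)‖ =
      (Fintype.card k : ℝ) ^ p.natDegree := by
  rw [norm_algebraMap (RatFunc.algebraMap_ne_zero hp), RatFunc.intDegree_polynomial, zpow_natCast]

theorem norm_algebraMap_const {c : k} (hc : c ≠ 0) :
    ‖algebraMap (RatFunc k) (LaurentAtInfty k) (algebraMap k (RatFunc k) c)‖ = 1 := by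
  have := norm_algebraMap_polynomial (p := Polynomial.C c) (Polynomial.C_ne_zero.mpr hc)
  rw [Polynomial.natDegree_C, pow_zero] at this
  rw [← this, IsScalarTower.algebraMap_apply k k[X] (RatFunc k), Polynomial.algebraMap_eq]

theorem norm_ratFunc_smul {B : Type*} [NormedCommRing B] [NormedAlgebra (LaurentAtInfty k) B]
    [Algebra (RatFunc k) B] [IsScalarTower (RatFunc k) (LaurentAtInfty k) B] (r : RatFunc k)
    (x : B) : ‖r • x‖ = ‖algebraMap (RatFunc k) (LaurentAtInfty k) r‖ * ‖x‖ := by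
  rw [← algebraMap_smul (LaurentAtInfty k), norm_smul]

theorem eq_zero_of_norm_algebraMap_polynomial_lt_one {p : k[X]}
    (h : ‖algebraMap (RatFunc k) (LaurentAtInfty k) (algebraMap k[X] (RatFunc k) p)‖ < 1) :
    p = 0 := by
  by_contra hp
  rw [norm_algebraMap_polynomial hp] at h
  exact absurd h (not_lt.mpr (one_le_pow₀ one_lt_card.le))

theorem exists_ratFunc_norm_sub_lt (a : LaurentAtInfty k) {ε : ℝ} (hε : 0 < ε) :
    ∃ f : RatFunc k, ‖a - algebraMap (RatFunc k) (LaurentAtInfty k) f‖ < ε := by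
  have h : DenseRange (algebraMap (RatFunc k) (LaurentAtInfty k)) := by
    let := Classical.decEq (RatFunc k)
    let := (RatFunc.inftyValued k).toUniformSpace
    exact UniformSpace.Completion.denseRange_coe
  obtain ⟨f, hf⟩ := Metric.denseRange_iff.mp h a ε hε
  exact ⟨f, by rwa [dist_eq_norm] at hf⟩

theorem exists_polynomial_norm_ratFunc_sub_lt_one (f : RatFunc k) :
    ∃ p : k[X], ‖algebraMap (RatFunc k) (LaurentAtInfty k) (f - algebraMap k[X] (RatFunc k) p)‖
      < 1 := by
  have hd : algebraMap k[X] (RatFunc k) f.denom ≠ 0 :=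
    RatFunc.algebraMap_ne_zero f.denom_ne_zero
  refine ⟨f.num /ₘ f.denom, ?_⟩
  have e : f - algebraMap k[X] (RatFunc k) (f.num /ₘ f.denom) =
      algebraMap k[X] (RatFunc k) (f.num %ₘ f.denom) / algebraMap k[X] (RatFunc k) f.denom := by
    rw [eq_div_iff hd, sub_mul]
    nth_rewrite 1 [← RatFunc.num_div_denom f]
    rw [div_mul_cancel₀ _ hd, ← map_mul, ← map_sub]
    congr 1
    rw [Polynomial.modByMonic_eq_sub_mul_div _ f.denom]
    ring
  rw [e, map_div₀, norm_div, norm_algebraMap_polynomial f.denom_ne_zero]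
  rw [div_lt_one (pow_pos card_pos _)]
  by_cases hr : f.num %ₘ f.denom = 0
  · rw [hr, map_zero, map_zero, norm_zero]
    exact pow_pos card_pos _
  · rw [norm_algebraMap_polynomial hr]
    refine pow_lt_pow_right₀ one_lt_card ?_
    exact Polynomial.natDegree_lt_natDegree hr
      (Polynomial.degree_modByMonic_lt _ f.monic_denom)

/-- `k((1/t))` is the sum of `k[t]` and the open unit ball. -/
theorem exists_polynomial_norm_sub_lt_one (a : LaurentAtInfty k) :
    ∃ p : k[X], ‖a - algebraMap (RatFunc k) (LaurentAtInfty k) (algebraMap k[X] (RatFunc k) p)‖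
      < 1 := by
  obtain ⟨f, hf⟩ := exists_ratFunc_norm_sub_lt a one_pos
  obtain ⟨p, hp⟩ := exists_polynomial_norm_ratFunc_sub_lt_one f
  refine ⟨p, ?_⟩
  rw [map_sub] at hp
  rw [← sub_add_sub_cancel]
  exact (IsUltrametricDist.norm_add_le_max _ _).trans_lt (max_lt hf hp)

theorem finite_polynomial_natDegree_le (n : ℕ) : {p : k[X] | p.natDegree ≤ n}.Finite := by
  have : Finite (Polynomial.degreeLE k n) := by
    rw [← Polynomial.degreeLT_succ_eq_degreeLE]
    exact Finite.of_equiv _ (Polynomial.degreeLTEquiv k (n + 1)).symm.toEquiv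
  refine Set.Finite.subset (Set.toFinite (Polynomial.degreeLE k n : Set k[X])) fun p hp => ?_
  exact Polynomial.mem_degreeLE.mpr (Polynomial.natDegree_le_iff_degree_le.mp hp)

/-- Closed balls are compact: up to a small error, their elements have the form `p / t ^ n` with `p`
among the finitely many polynomials of bounded degree. -/
instance : ProperSpace (LaurentAtInfty k) := by
  refine ⟨fun x r => ?_⟩
  refine TotallyBounded.isCompact_of_isClosed ?_ Metric.isClosed_closedBall
  suffices h : TotallyBounded (Metric.closedBall (0 : LaurentAtInfty k) r) by
    refine TotallyBounded.subset ?_ (h.image (f := fun y => x + y)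
      (uniformContinuous_const.add uniformContinuous_id))
    refine fun y hy => ⟨y - x, ?_, by simp⟩
    simpa [dist_eq_norm] using hy
  rw [Metric.totallyBounded_iff]
  intro ε hε
  obtain ⟨n, hn⟩ := exists_pow_lt_of_lt_one hε (inv_lt_one_of_one_lt₀ (one_lt_card (k := k)))
  obtain ⟨m, hm⟩ := pow_unbounded_of_one_lt (r * (Fintype.card k : ℝ) ^ n) (one_lt_card (k := k))
  let φ : RatFunc k →+* LaurentAtInfty k := algebraMap _ _
  have hX : (φ RatFunc.X) ^ n ≠ 0 := pow_ne_zero _ ((map_ne_zero φ).mpr RatFunc.X_ne_zero)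
  have hXn : ‖(φ RatFunc.X) ^ n‖ = (Fintype.card k : ℝ) ^ n := by
    rw [norm_pow]
    congr 1
    exact norm_algebraMap_X
  refine ⟨(fun p : k[X] => φ (algebraMap k[X] (RatFunc k) p) / (φ RatFunc.X) ^ n) ''
    {p | p.natDegree ≤ m}, (finite_polynomial_natDegree_le m).image _, fun y hy => ?_⟩
  obtain ⟨p, hp⟩ := exists_polynomial_norm_sub_lt_one (y * φ RatFunc.X ^ n)
  rw [mem_closedBall_zero_iff] at hy
  refine Set.mem_biUnion ⟨p, ?_, rfl⟩ ?_
  · by_cases hp0 : p = 0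
    · simp [hp0]
    refine (pow_le_pow_iff_right₀ (one_lt_card (k := k))).mp ?_
    rw [← norm_algebraMap_polynomial hp0]
    rw [norm_sub_rev] at hp
    rw [← sub_add_cancel (algebraMap (RatFunc k) (LaurentAtInfty k) (algebraMap k[X] (RatFunc k) p))
      (y * φ RatFunc.X ^ n)]
    refine (IsUltrametricDist.norm_add_le_max _ _).trans (max_le ?_ ?_)
    · exact hp.le.trans (one_le_pow₀ one_lt_card.le)
    · rw [norm_mul, hXn]
      exact (mul_le_mul_of_nonneg_right hy (pow_nonneg card_pos.le _)).trans hm.le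
  · rw [Metric.mem_ball, dist_eq_norm]
    have e : y - φ (algebraMap k[X] (RatFunc k) p) / φ RatFunc.X ^ n =
      (y * φ RatFunc.X ^ n - φ (algebraMap k[X] (RatFunc k) p)) / φ RatFunc.X ^ n := by
      field_simp
    rw [e, norm_div, hXn, div_lt_iff₀ (pow_pos card_pos n)]
    refine hp.trans_le ?_
    rw [inv_pow, inv_lt_comm₀ (pow_pos card_pos n) hε] at hn
    calc (1 : ℝ) = ε * ε⁻¹ := (mul_inv_cancel₀ hε.ne').symm
      _ ≤ _ := mul_le_mul_of_nonneg_left hn.le hε.le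

end Local

/-! ### The normed algebra `K_∞` -/

section KInfty

/-- `K_∞`, the tensor product over `k(t)` of `k((1/t))` and `K`. -/
def KInfty (k K : Type*) [Field k] [Field K] [Algebra (RatFunc k) K] : Type _ :=
  LaurentAtInfty k ⊗[RatFunc k] K

namespace KInfty

variable (k : Type*) [Field k] (K : Type*) [Field K] [Algebra (RatFunc k) K]

instance : CommRing (KInfty k K) := inferInstanceAs (CommRing (LaurentAtInfty k ⊗[RatFunc k] K))

instance : Algebra (LaurentAtInfty k) (KInfty k K) :=
  inferInstanceAs (Algebra (LaurentAtInfty k) (LaurentAtInfty k ⊗[RatFunc k] K))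

instance : Algebra (RatFunc k) (KInfty k K) :=
  inferInstanceAs (Algebra (RatFunc k) (LaurentAtInfty k ⊗[RatFunc k] K))

instance : IsScalarTower (RatFunc k) (LaurentAtInfty k) (KInfty k K) :=
  inferInstanceAs (IsScalarTower (RatFunc k) (LaurentAtInfty k) (LaurentAtInfty k ⊗[RatFunc k] K))

instance : Algebra k[X] (KInfty k K) :=
  ((algebraMap (RatFunc k) (KInfty k K)).comp (algebraMap k[X] (RatFunc k))).toAlgebra

instance : IsScalarTower k[X] (RatFunc k) (KInfty k K) := IsScalarTower.of_algebraMap_eq' rfl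

instance : Algebra k (KInfty k K) :=
  ((algebraMap (RatFunc k) (KInfty k K)).comp (algebraMap k (RatFunc k))).toAlgebra

instance : IsScalarTower k (RatFunc k) (KInfty k K) := IsScalarTower.of_algebraMap_eq' rfl

instance : IsScalarTower k k[X] (KInfty k K) := IsScalarTower.of_algebraMap_eq fun c => by
  rw [IsScalarTower.algebraMap_apply k (RatFunc k),
    IsScalarTower.algebraMap_apply k k[X] (RatFunc k),
    ← IsScalarTower.algebraMap_apply k[X] (RatFunc k)]

instance [FunctionField k K] : Module.Finite (LaurentAtInfty k) (KInfty k K) :=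
  inferInstanceAs (Module.Finite (LaurentAtInfty k) (LaurentAtInfty k ⊗[RatFunc k] K))

/-- The canonical map `K → K_∞`. -/
def ofK : K →ₐ[RatFunc k] KInfty k K :=
  (Algebra.TensorProduct.includeRight : K →ₐ[RatFunc k] LaurentAtInfty k ⊗[RatFunc k] K)

variable [FunctionField k K]

/-- The basis of `K_∞` over `k((1/t))` coming from a fixed basis of `K` over `k(t)`. -/
def basis : Module.Basis (Fin (Module.finrank (RatFunc k) K)) (LaurentAtInfty k) (KInfty k K) :=
  Algebra.TensorProduct.basis (LaurentAtInfty k) (Module.finBasis (RatFunc k) K)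

variable {k K}

theorem basis_apply (i) : basis k K i = ofK k K (Module.finBasis (RatFunc k) K i) :=
  Algebra.TensorProduct.basis_apply _ i

theorem repr_ofK (x : K) (i) : (basis k K).repr (ofK k K x) i =
    algebraMap (RatFunc k) (LaurentAtInfty k) ((Module.finBasis (RatFunc k) K).repr x i) := by
  have h := DFunLike.congr_fun (Algebra.TensorProduct.basis_repr_tmul
    (Module.finBasis (RatFunc k) K) (1 : LaurentAtInfty k) x) i
  rw [one_smul, Finsupp.mapRange_apply] at h
  exact h

theorem ofK_injective : Function.Injective (ofK k K) := by
  refine (injective_iff_map_eq_zero _).mpr fun x hx => ?_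
  refine (Module.finBasis (RatFunc k) K).ext_elem fun i => ?_
  refine (algebraMap (RatFunc k) (LaurentAtInfty k)).injective ?_
  rw [← repr_ofK, hx]
  simp

variable [Fintype k]

variable (k K) in
/-- A bound for the norms of the structure constants of the basis. -/
def normConst : ℝ := 1 + ∑ i, ∑ j, ‖(basis k K).equivFun (basis k K i * basis k K j)‖

theorem one_le_normConst : 1 ≤ normConst k K :=
  le_add_of_nonneg_right (Finset.sum_nonneg fun _ _ => Finset.sum_nonneg fun _ _ => norm_nonneg _)

theorem normConst_pos : 0 < normConst k K := zero_lt_one.trans_le one_le_normConst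

/-- The supremum norm with respect to the basis, scaled so that it is submultiplicative. -/
instance : Norm (KInfty k K) := ⟨fun x => normConst k K * ‖(basis k K).equivFun x‖⟩

theorem norm_def (x : KInfty k K) : ‖x‖ = normConst k K * ‖(basis k K).equivFun x‖ := rfl

theorem norm_mul_le' (x y : KInfty k K) : ‖x * y‖ ≤ ‖x‖ * ‖y‖ := by
  have key : ‖(basis k K).equivFun (x * y)‖ ≤
      normConst k K * ‖(basis k K).equivFun x‖ * ‖(basis k K).equivFun y‖ := by
    have hnn : 0 ≤ normConst k K * ‖(basis k K).equivFun x‖ * ‖(basis k K).equivFun y‖ :=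
      mul_nonneg (mul_nonneg normConst_pos.le (norm_nonneg _)) (norm_nonneg _)
    conv_lhs => rw [← (basis k K).sum_equivFun x, ← (basis k K).sum_equivFun y]
    rw [Finset.sum_mul_sum, map_sum]
    refine IsUltrametricDist.norm_sum_le_of_forall_le_of_nonneg hnn fun i _ => ?_
    rw [map_sum]
    refine IsUltrametricDist.norm_sum_le_of_forall_le_of_nonneg hnn fun j _ => ?_
    have hC : ‖(basis k K).equivFun (basis k K i * basis k K j)‖ ≤ normConst k K := by
      refine le_trans ?_ (le_add_of_nonneg_left zero_le_one)
      refine le_trans ?_ (Finset.single_le_sum (f := fun i => ∑ j,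
        ‖(basis k K).equivFun (basis k K i * basis k K j)‖)
        (fun _ _ => Finset.sum_nonneg fun _ _ => norm_nonneg _) (Finset.mem_univ i))
      exact Finset.single_le_sum (f := fun j =>
        ‖(basis k K).equivFun (basis k K i * basis k K j)‖)
        (fun _ _ => norm_nonneg _) (Finset.mem_univ j)
    rw [smul_mul_smul_comm, map_smul, norm_smul, norm_mul]
    calc _ ≤ ‖(basis k K).equivFun x‖ * ‖(basis k K).equivFun y‖ * normConst k K :=
          mul_le_mul (mul_le_mul (norm_le_pi_norm _ i) (norm_le_pi_norm _ j) (norm_nonneg _)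
            (norm_nonneg _)) hC (norm_nonneg _) (by positivity)
      _ = _ := by ring
  rw [norm_def, norm_def, norm_def]
  refine (mul_le_mul_of_nonneg_left key normConst_pos.le).trans_eq ?_
  ring

instance : NormedCommRing (KInfty k K) :=
  { AddGroupNorm.toNormedAddCommGroup
      { toFun := fun x : KInfty k K => ‖x‖
        map_zero' := by simp [norm_def]
        add_le' := fun x y => by
          simp only [norm_def, map_add, ← mul_add]
          exact mul_le_mul_of_nonneg_left (norm_add_le _ _) normConst_pos.le
        neg' := fun x => by simp only [norm_def, map_neg, norm_neg]
        eq_zero_of_map_eq_zero' := fun x hx => by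
          simpa [norm_def, normConst_pos.ne'] using hx },
    (inferInstance : CommRing (KInfty k K)) with
    norm_mul_le := norm_mul_le' }

instance : NormedAlgebra (LaurentAtInfty k) (KInfty k K) where
  norm_smul_le r x := by
    rw [norm_def, norm_def, map_smul, norm_smul]
    exact (mul_left_comm _ _ _).le

instance : IsUltrametricDist (KInfty k K) := by
  refine IsUltrametricDist.isUltrametricDist_of_forall_norm_add_le_max_norm fun x y => ?_
  rw [norm_def, norm_def, norm_def, map_add, ← mul_max_of_nonneg _ _ normConst_pos.le]
  exact mul_le_mul_of_nonneg_left (IsUltrametricDist.norm_add_le_max _ _) normConst_pos.le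

instance : ProperSpace (KInfty k K) := FiniteDimensional.proper (LaurentAtInfty k) (KInfty k K)

instance : CompleteSpace (KInfty k K) := inferInstance

theorem norm_X_smul (x : KInfty k K) :
    ‖(RatFunc.X : RatFunc k) • x‖ = Fintype.card k * ‖x‖ := by
  rw [norm_ratFunc_smul, norm_algebraMap_X]

theorem norm_basis (i) : ‖basis k K i‖ = normConst k K := by
  have e : (basis k K).equivFun (basis k K i) = fun j => if i = j then 1 else 0 :=
    funext fun j => (basis k K).equivFun_self i j
  rw [norm_def, e]
  have : ‖(fun j => if i = j then (1 : LaurentAtInfty k) else 0)‖ = 1 := by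
    refine le_antisymm ((pi_norm_le_iff_of_nonneg zero_le_one).mpr fun j => ?_) ?_
    · split_ifs <;> simp
    · simpa using norm_le_pi_norm (fun j => if i = j then (1 : LaurentAtInfty k) else 0) i
  rw [this, mul_one]

theorem norm_repr_le (x : KInfty k K) (i) : ‖(basis k K).repr x i‖ ≤ ‖x‖ / normConst k K := by
  rw [norm_def, mul_div_cancel_left₀ _ normConst_pos.ne']
  exact norm_le_pi_norm ((basis k K).equivFun x) i

theorem norm_lt_of_repr_lt {x : KInfty k K} {r : ℝ} (hr : 0 < r)
    (h : ∀ i, ‖(basis k K).repr x i‖ < r / normConst k K) : ‖x‖ < r := by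
  rw [norm_def, mul_comm, ← lt_div_iff₀ normConst_pos,
    pi_norm_lt_iff (div_pos hr normConst_pos)]
  exact h

/-- The field `K` is dense in `K_∞`. -/
theorem exists_norm_sub_ofK_lt (a : KInfty k K) {ε : ℝ} (hε : 0 < ε) :
    ∃ x : K, ‖a - ofK k K x‖ < ε := by
  choose f hf using fun i => exists_ratFunc_norm_sub_lt ((basis k K).repr a i)
    (div_pos hε (normConst_pos (k := k) (K := K)))
  refine ⟨(Module.finBasis (RatFunc k) K).equivFun.symm f, norm_lt_of_repr_lt hε fun i => ?_⟩
  rw [map_sub, Finsupp.sub_apply, repr_ofK]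
  convert hf i
  rw [← Module.Basis.equivFun_apply, LinearEquiv.apply_symm_apply]

end KInfty
end KInfty

/-! ### Entire additive power series -/

section Series

open Filter Topology

theorem norm_le_of_hasSum {B ι : Type*} [SeminormedAddCommGroup B] [IsUltrametricDist B]
    {f : ι → B} {s : B} {C : ℝ} (hC : 0 ≤ C) (h : HasSum f s) (hf : ∀ i, ‖f i‖ ≤ C) : ‖s‖ ≤ C :=
  le_of_tendsto h.norm (Eventually.of_forall fun _ =>
    IsUltrametricDist.norm_sum_le_of_forall_le_of_nonneg hC fun i _ => hf i)

theorem norm_sub_le_max_of_isUltrametricDist {B : Type*} [SeminormedAddCommGroup B]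
    [IsUltrametricDist B] (x y : B) : ‖x - y‖ ≤ max ‖x‖ ‖y‖ := by
  rw [sub_eq_add_neg, ← norm_neg y]
  exact IsUltrametricDist.norm_add_le_max x (-y)

/-- An additive map that is close to the identity on a ball maps this ball onto itself. -/
theorem exists_eq_of_norm_sub_le {B : Type*} [NormedAddCommGroup B] [IsUltrametricDist B]
    [CompleteSpace B] (f : B →+ B) {c : ℝ≥0} (hc : c < 1) {r : ℝ}
    (hf : ∀ y, ‖y‖ ≤ r → ‖f y - y‖ ≤ c * ‖y‖) {x : B} (hx : ‖x‖ ≤ r) :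
    ∃ y, ‖y‖ ≤ r ∧ f y = x := by
  have hcl : IsComplete (Metric.closedBall (0 : B) r) := Metric.isClosed_closedBall.isComplete
  have hm : Set.MapsTo (fun y => x - (f y - y)) (Metric.closedBall (0 : B) r)
      (Metric.closedBall (0 : B) r) := by
    intro y hy
    rw [mem_closedBall_zero_iff] at hy ⊢
    refine (norm_sub_le_max_of_isUltrametricDist _ _).trans (max_le hx ((hf y hy).trans ?_))
    exact (mul_le_of_le_one_left (norm_nonneg y) (by exact_mod_cast hc.le)).trans hy
  have hk : ContractingWith c (hm.restrict _ _ _) := by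
    refine ⟨hc, LipschitzWith.of_dist_le_mul fun y z => ?_⟩
    rw [Subtype.dist_eq, Subtype.dist_eq, dist_eq_norm, dist_eq_norm]
    simp only [Set.MapsTo.val_restrict_apply]
    have e : x - (f y.1 - y.1) - (x - (f z.1 - z.1)) = -(f (y.1 - z.1) - (y.1 - z.1)) := by
      rw [map_sub]
      abel
    rw [e, norm_neg]
    refine hf _ ((norm_sub_le_max_of_isUltrametricDist _ _).trans (max_le ?_ ?_))
    · exact mem_closedBall_zero_iff.mp y.2
    · exact mem_closedBall_zero_iff.mp z.2
  obtain ⟨y, hy, hfix, -⟩ := hk.exists_fixedPoint' hcl hm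
    (Metric.mem_closedBall_self ((norm_nonneg x).trans hx)) (edist_ne_top _ _)
  refine ⟨y, mem_closedBall_zero_iff.mp hy, ?_⟩
  have : x - (f y - y) = y := hfix
  rw [sub_eq_iff_eq_add] at this
  simpa using this.symm

variable {k : Type*} [Field k] [Fintype k]

/-- The coefficients of an additive power series `Y + ∑ a (i + 1) * Y ^ (q ^ (i + 1))` that are
small enough to make the series converge everywhere, and to make it close to the identity on the
unit ball. -/
def IsEntireCoeff (a : ℕ → RatFunc k) : Prop :=
  a 0 = 1 ∧ ∀ i, ‖algebraMap (RatFunc k) (LaurentAtInfty k) (a (i + 1))‖ ≤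
    (Fintype.card k : ℝ)⁻¹ ^ (i * Fintype.card k ^ (i + 1) + 1)

variable {B : Type*} [NormedCommRing B] [IsUltrametricDist B] [CompleteSpace B]
  [NormedAlgebra (LaurentAtInfty k) B] [Algebra (RatFunc k) B]
  [IsScalarTower (RatFunc k) (LaurentAtInfty k) B]

omit [IsUltrametricDist B] [CompleteSpace B] in
theorem IsEntireCoeff.norm_le {a : ℕ → RatFunc k} (ha : IsEntireCoeff a) (y : B) (i : ℕ) :
    ‖a (i + 1) • y ^ Fintype.card k ^ (i + 1)‖ ≤
      (Fintype.card k : ℝ)⁻¹ * ((Fintype.card k : ℝ)⁻¹ ^ i * ‖y‖) ^ Fintype.card k ^ (i + 1) := by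
  rw [norm_ratFunc_smul]
  have hq : (0 : ℝ) < (Fintype.card k : ℝ)⁻¹ := inv_pos.mpr card_pos
  refine (mul_le_mul (ha.2 i) (norm_pow_le' y (pow_pos Fintype.card_pos _)) (norm_nonneg _)
    (pow_nonneg hq.le _)).trans_eq ?_
  rw [mul_pow, ← pow_mul, pow_succ]
  ring

theorem IsEntireCoeff.summable {a : ℕ → RatFunc k} (ha : IsEntireCoeff a) (y : B) :
    Summable fun i => a i • y ^ Fintype.card k ^ i := by
  rw [← summable_nat_add_iff 1]
  refine NonarchimedeanAddGroup.summable_of_tendsto_cofinite_zero ?_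
  rw [Nat.cofinite_eq_atTop]
  have hq : (0 : ℝ) < (Fintype.card k : ℝ)⁻¹ := inv_pos.mpr card_pos
  have h1 : Tendsto (fun i : ℕ => (Fintype.card k : ℝ)⁻¹ ^ i * ‖y‖) atTop (𝓝 0) := by
    simpa using (tendsto_pow_atTop_nhds_zero_of_lt_one hq.le
      (inv_lt_one_of_one_lt₀ (one_lt_card (k := k)))).mul_const ‖y‖
  refine squeeze_zero_norm' ?_ h1
  filter_upwards [h1.eventually_le_const (zero_lt_one)] with i hi
  refine (ha.norm_le y i).trans ?_
  have h0 : 0 ≤ (Fintype.card k : ℝ)⁻¹ ^ i * ‖y‖ := by positivity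
  refine (mul_le_of_le_one_left (pow_nonneg h0 _)
    (inv_lt_one_of_one_lt₀ (one_lt_card (k := k))).le).trans ?_
  exact pow_le_of_le_one h0 hi (pow_pos Fintype.card_pos _).ne'

/-- The additive map given by an entire additive power series. -/
def additiveSeries {a : ℕ → RatFunc k} (ha : IsEntireCoeff a) : B →+ B where
  toFun y := ∑' i, a i • y ^ Fintype.card k ^ i
  map_zero' := by
    have h : ∀ i : ℕ, Fintype.card k ^ i ≠ 0 := fun i => pow_ne_zero _ Fintype.card_ne_zero
    simp only [zero_pow (h _), smul_zero, tsum_zero]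
  map_add' x y := by
    simp only [add_pow_card_pow, smul_add]
    exact (ha.summable x).tsum_add (ha.summable y)

theorem hasSum_additiveSeries {a : ℕ → RatFunc k} (ha : IsEntireCoeff a) (y : B) :
    HasSum (fun i => a i • y ^ Fintype.card k ^ i) (additiveSeries ha y) :=
  (ha.summable y).hasSum

theorem norm_additiveSeries_sub_le {a : ℕ → RatFunc k} (ha : IsEntireCoeff a) {y : B}
    (hy : ‖y‖ ≤ 1) : ‖additiveSeries ha y - y‖ ≤ (Fintype.card k : ℝ)⁻¹ * ‖y‖ := by
  have hq : (0 : ℝ) < (Fintype.card k : ℝ)⁻¹ := inv_pos.mpr card_pos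
  have h := (hasSum_nat_add_iff' 1).mpr (hasSum_additiveSeries ha y)
  simp only [Finset.range_one, Finset.sum_singleton, pow_zero, pow_one, ha.1, one_smul] at h
  refine norm_le_of_hasSum (by positivity) h fun i => (ha.norm_le y i).trans ?_
  refine mul_le_mul_of_nonneg_left ?_ hq.le
  have h1 : (Fintype.card k : ℝ)⁻¹ ^ i * ‖y‖ ≤ ‖y‖ :=
    mul_le_of_le_one_left (norm_nonneg y)
      (pow_le_one₀ hq.le (inv_lt_one_of_one_lt₀ (one_lt_card (k := k))).le)
  refine le_trans (pow_le_of_le_one (by positivity) (h1.trans hy)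
    (pow_pos Fintype.card_pos _).ne') h1

theorem norm_additiveSeries {a : ℕ → RatFunc k} (ha : IsEntireCoeff a) {y : B}
    (hy : ‖y‖ ≤ 1) : ‖additiveSeries ha y‖ = ‖y‖ := by
  rcases eq_or_ne y 0 with rfl | h0
  · rw [map_zero]
  have h : ‖additiveSeries ha y - y‖ < ‖y‖ := (norm_additiveSeries_sub_le ha hy).trans_lt
    (mul_lt_of_lt_one_left (norm_pos_iff.mpr h0) (inv_lt_one_of_one_lt₀ (one_lt_card (k := k))))
  rw [← sub_add_cancel (additiveSeries ha y) y]
  rw [IsUltrametricDist.norm_add_eq_max_of_norm_ne_norm h.ne, max_eq_right h.le]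

theorem exists_additiveSeries_eq {a : ℕ → RatFunc k} (ha : IsEntireCoeff a) {x : B} {r : ℝ}
    (hr : r ≤ 1) (hx : ‖x‖ ≤ r) : ∃ y, ‖y‖ ≤ r ∧ additiveSeries ha y = x := by
  refine exists_eq_of_norm_sub_le (additiveSeries ha) (c := (Fintype.card k : ℝ≥0)⁻¹) ?_
    (fun y hy => ?_) hx
  · exact inv_lt_one_of_one_lt₀ (by exact_mod_cast Fintype.one_lt_card)
  · simpa using norm_additiveSeries_sub_le ha (hy.trans hr)

/-! ### The exponential of the Carlitz module -/

theorem norm_X_pow_sub_X (n : ℕ) :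
    ‖algebraMap (RatFunc k) (LaurentAtInfty k) (RatFunc.X ^ Fintype.card k ^ (n + 1) - RatFunc.X)‖ =
      (Fintype.card k : ℝ) ^ Fintype.card k ^ (n + 1) := by
  have h : 1 < Fintype.card k ^ (n + 1) := Nat.one_lt_pow (Nat.succ_ne_zero n) Fintype.one_lt_card
  have h1 : ‖algebraMap (RatFunc k) (LaurentAtInfty k) RatFunc.X‖ <
      ‖(algebraMap (RatFunc k) (LaurentAtInfty k) RatFunc.X) ^ Fintype.card k ^ (n + 1)‖ := by
    rw [norm_pow, norm_algebraMap_X]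
    exact lt_self_pow₀ one_lt_card h
  rw [map_sub, map_pow, sub_eq_add_neg, IsUltrametricDist.norm_add_eq_max_of_norm_ne_norm
    (by rw [norm_neg]; exact h1.ne'), norm_neg, max_eq_left h1.le, norm_pow, norm_algebraMap_X]

theorem norm_carlitzCoeff (i : ℕ) :
    ‖algebraMap (RatFunc k) (LaurentAtInfty k) (carlitzCoeff k i)‖ =
      (Fintype.card k : ℝ)⁻¹ ^ (i * Fintype.card k ^ i) := by
  induction i with
  | zero => simp [carlitzCoeff]
  | succ i ih =>
    rw [carlitzCoeff, map_div₀, map_pow, norm_div, norm_pow, ih, norm_X_pow_sub_X, div_eq_mul_inv,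
      ← inv_pow, ← pow_mul, ← pow_add]
    congr 1
    ring

variable (k) in
theorem isEntireCoeff_carlitzCoeff : IsEntireCoeff (carlitzCoeff k) := by
  refine ⟨rfl, fun i => ?_⟩
  rw [norm_carlitzCoeff]
  refine pow_le_pow_of_le_one (inv_nonneg.mpr card_pos.le)
    (inv_lt_one_of_one_lt₀ (one_lt_card (k := k))).le ?_
  have : 0 < Fintype.card k ^ (i + 1) := pow_pos Fintype.card_pos _
  rw [add_mul]
  lia

variable (k B) in
/-- The exponential map of the Carlitz module. -/
def carlitzExp : B →+ B := additiveSeries (isEntireCoeff_carlitzCoeff k)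

theorem isCarlitzExp_carlitzExp (y : B) : IsCarlitzExp k y (carlitzExp k B y) :=
  hasSum_additiveSeries (isEntireCoeff_carlitzCoeff k) y

theorem isCarlitzExp_iff {y x : B} : IsCarlitzExp k y x ↔ carlitzExp k B y = x :=
  ⟨fun h => (isCarlitzExp_carlitzExp y).unique h, fun h => h ▸ isCarlitzExp_carlitzExp y⟩

theorem carlitzExp_X_smul (y : B) : carlitzExp k B ((RatFunc.X : RatFunc k) • y) =
    (RatFunc.X : RatFunc k) • carlitzExp k B y + carlitzExp k B y ^ Fintype.card k :=
  isCarlitzExp_iff.mp (isCarlitzExp_carlitzExp y).X_smul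

theorem carlitzExp_const_smul (c : k) (y : B) :
    carlitzExp k B (algebraMap k (RatFunc k) c • y) =
      algebraMap k (RatFunc k) c • carlitzExp k B y :=
  isCarlitzExp_iff.mp ((isCarlitzExp_carlitzExp y).const_smul c)

/-- The exponents `(q ^ i - 1) / (q - 1)`. -/
def repunit (q : ℕ) : ℕ → ℕ
  | 0 => 0
  | i + 1 => q * repunit q i + 1

theorem repunit_lt {q : ℕ} (hq : 1 < q) (i : ℕ) : repunit q i < q ^ i := by
  induction i with
  | zero => simp [repunit]
  | succ i ih =>
    rw [repunit, pow_succ']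
    calc q * repunit q i + 1 < q * repunit q i + q := by lia
      _ = q * (repunit q i + 1) := by ring
      _ ≤ q * q ^ i := Nat.mul_le_mul_left q ih

theorem le_repunit {q : ℕ} (hq : 1 < q) (i : ℕ) : i ≤ repunit q i := by
  induction i with
  | zero => exact Nat.zero_le _
  | succ i ih =>
    rw [repunit]
    nlinarith

theorem pow_card_pow_eq {B : Type*} [CommRing B] [Algebra (RatFunc k) B] {τ : B}
    (h : τ ^ Fintype.card k = -((RatFunc.X : RatFunc k) • τ)) (i : ℕ) :
    τ ^ Fintype.card k ^ i =
      ((-RatFunc.X : RatFunc k) ^ repunit (Fintype.card k) i) • τ := by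
  induction i with
  | zero => simp [repunit]
  | succ i ih =>
    rw [pow_succ, pow_mul, ih, smul_pow, h, ← neg_smul, smul_smul, ← pow_mul, ← pow_succ, repunit,
      mul_comm]

/-- Every `t`-torsion point is a value of the exponential. It is enough to look for a preimage
among the multiples `c • τ` with `c` in `k((1/t))`: the exponential of `c • τ` is `f c • τ` for an
entire additive power series `f` in `c`, which takes the value `1` on the unit ball. -/
theorem exists_carlitzExp_eq_of_torsion {τ : B}
    (h : τ ^ Fintype.card k = -((RatFunc.X : RatFunc k) • τ)) : ∃ z, carlitzExp k B z = τ := by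
  have ha : IsEntireCoeff fun i => carlitzCoeff k i *
      (-RatFunc.X : RatFunc k) ^ repunit (Fintype.card k) i := by
    refine ⟨by simp [carlitzCoeff, repunit], fun i => ?_⟩
    rw [map_mul, norm_mul, norm_carlitzCoeff, map_pow, norm_pow, map_neg, norm_neg,
      norm_algebraMap_X]
    have hq0 : (Fintype.card k : ℝ) ≠ 0 := card_pos.ne'
    have hlt := repunit_lt (Fintype.one_lt_card (α := k)) (i + 1)
    have e : (i + 1) * Fintype.card k ^ (i + 1) = (i * Fintype.card k ^ (i + 1) + 1) +
        (Fintype.card k ^ (i + 1) - 1 - repunit (Fintype.card k) (i + 1)) +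
          repunit (Fintype.card k) (i + 1) := by
      rw [add_mul]
      lia
    rw [e, pow_add, mul_assoc, ← mul_pow, inv_mul_cancel₀ hq0, one_pow, mul_one]
    refine pow_le_pow_of_le_one (inv_nonneg.mpr card_pos.le)
      (inv_lt_one_of_one_lt₀ (one_lt_card (k := k))).le ?_
    lia
  obtain ⟨c, -, hc⟩ := exists_additiveSeries_eq ha (x := (1 : LaurentAtInfty k)) le_rfl
    norm_one.le
  refine ⟨c • τ, isCarlitzExp_iff.mp ?_⟩
  have h1 := (hasSum_additiveSeries ha c).smul_const τ
  rw [hc, one_smul] at h1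
  unfold IsCarlitzExp
  convert h1 using 1
  funext i
  rw [smul_pow, pow_card_pow_eq h]
  simp only [Algebra.smul_def, IsScalarTower.algebraMap_apply (RatFunc k) (LaurentAtInfty k) B,
    map_mul, map_pow]
  ring

end Series

/-! ### Galois invariants -/

section Descent

variable {k : Type*} [Field k] {K : Type*} [Field K] [Algebra (RatFunc k) K]

variable (k K) in
/-- The canonical map from `K_∞` to `K_∞^sep`. -/
def toSep : KInfty k K →ₐ[RatFunc k] KInftySep k K :=
  (Algebra.TensorProduct.map (IsScalarTower.toAlgHom (RatFunc k) (LaurentAtInfty k) (LaurentSep k))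
    (AlgHom.id (RatFunc k) K) :
      LaurentAtInfty k ⊗[RatFunc k] K →ₐ[RatFunc k] LaurentSep k ⊗[RatFunc k] K)

theorem toSep_ofK (x : K) : toSep k K (KInfty.ofK k K x) = toKInftySep k K x := by
  change Algebra.TensorProduct.map _ _ ((1 : LaurentAtInfty k) ⊗ₜ[RatFunc k] x) = _
  rw [Algebra.TensorProduct.map_tmul, map_one]
  rfl

theorem toSep_algebraMap (a : LaurentAtInfty k) :
    toSep k K (algebraMap (LaurentAtInfty k) _ a) =
      algebraMap (LaurentSep k) _ (algebraMap (LaurentAtInfty k) (LaurentSep k) a) := by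
  change Algebra.TensorProduct.map _ _ (a ⊗ₜ[RatFunc k] (1 : K)) = _
  rw [Algebra.TensorProduct.map_tmul, map_one]
  rfl

theorem toSep_smul (a : LaurentAtInfty k) (y : KInfty k K) :
    toSep k K (a • y) = algebraMap (LaurentAtInfty k) (LaurentSep k) a • toSep k K y := by
  rw [Algebra.smul_def, map_mul, toSep_algebraMap, ← Algebra.smul_def]

variable [FunctionField k K]

variable (k K) in
/-- The basis of `K_∞^sep` over `k((1/t))^sep` coming from a fixed basis of `K` over `k(t)`. -/
def sepBasis :
    Module.Basis (Fin (Module.finrank (RatFunc k) K)) (LaurentSep k) (KInftySep k K) :=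
  Algebra.TensorProduct.basis (LaurentSep k) (Module.finBasis (RatFunc k) K)

theorem sepBasis_apply (i) :
    sepBasis k K i = toKInftySep k K (Module.finBasis (RatFunc k) K i) :=
  Algebra.TensorProduct.basis_apply _ i

theorem toSep_eq_sum (y : KInfty k K) : toSep k K y =
    ∑ i, algebraMap (LaurentAtInfty k) (LaurentSep k) ((KInfty.basis k K).repr y i) •
      sepBasis k K i := by
  conv_lhs => rw [← (KInfty.basis k K).sum_repr y]
  simp only [map_sum, toSep_smul, KInfty.basis_apply, toSep_ofK, sepBasis_apply]

theorem sepBasis_repr_toSep (y : KInfty k K) (i) : (sepBasis k K).repr (toSep k K y) i =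
    algebraMap (LaurentAtInfty k) (LaurentSep k) ((KInfty.basis k K).repr y i) := by
  rw [toSep_eq_sum, Module.Basis.repr_sum_self]

theorem toSep_injective : Function.Injective (toSep k K) := by
  refine (injective_iff_map_eq_zero _).mpr fun y hy => ?_
  refine (KInfty.basis k K).ext_elem fun i => ?_
  refine (algebraMap (LaurentAtInfty k) (LaurentSep k)).injective ?_
  rw [← sepBasis_repr_toSep, hy]
  simp

/-- An element of `K_∞^sep` that is fixed by the Galois group comes from `K_∞`. -/
theorem exists_toSep_eq_of_fixed {z : KInftySep k K}
    (hz : ∀ σ : GalInfty k, galoisMap k K σ z = z) : ∃ y, toSep k K y = z := by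
  have h (i) : ∃ a : LaurentAtInfty k, algebraMap _ (LaurentSep k) a = (sepBasis k K).repr z i := by
    have hfix (σ : GalInfty k) : σ ((sepBasis k K).repr z i) = (sepBasis k K).repr z i := by
      have e : galoisMap k K σ z = ∑ i, σ ((sepBasis k K).repr z i) • sepBasis k K i := by
        conv_lhs => rw [← (sepBasis k K).sum_repr z]
        simp only [map_sum, galoisMap_smul, sepBasis_apply, galoisMap_toKInftySep]
      conv_rhs => rw [← hz σ, e, Module.Basis.repr_sum_self]
    have := (InfiniteGalois.mem_bot_iff_fixed (k := LaurentAtInfty k) (K := LaurentSep k)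
      ((sepBasis k K).repr z i)).mpr hfix
    exact IntermediateField.mem_bot.mp this
  choose a ha using h
  refine ⟨(KInfty.basis k K).equivFun.symm a, (sepBasis k K).ext_elem fun i => ?_⟩
  rw [sepBasis_repr_toSep, ← ha, ← Module.Basis.equivFun_apply, LinearEquiv.apply_symm_apply]

theorem galoisMap_toSep (σ : GalInfty k) (y : KInfty k K) :
    galoisMap k K σ (toSep k K y) = toSep k K y := by
  rw [toSep_eq_sum]
  simp only [map_sum, galoisMap_smul, sepBasis_apply, galoisMap_toKInftySep, AlgEquiv.commutes]

variable [Fintype k]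

instance : T2Space (KInftySep k K) := by
  have hc (i) : Continuous fun z => (sepBasis k K).repr z i :=
    IsModuleTopology.continuous_of_linearMap ((sepBasis k K).coord i)
  refine T2Space.of_injective_continuous (f := fun z i => (sepBasis k K).repr z i)
    (fun z z' h => (sepBasis k K).ext_elem fun i => congrFun h i) (continuous_pi hc)

theorem continuous_toSep : Continuous (toSep k K) := by
  have hc (i) : Continuous fun y => (KInfty.basis k K).repr y i :=
    LinearMap.continuous_of_finiteDimensional ((KInfty.basis k K).coord i)
  have hL : Continuous (algebraMap (LaurentAtInfty k) (LaurentSep k)) := by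
    have : Isometry (algebraMap (LaurentAtInfty k) (LaurentSep k)) :=
      AddMonoidHomClass.isometry_of_norm _ fun a => spectralNorm_extends a
    exact this.continuous
  simp only [funext toSep_eq_sum]
  exact continuous_finsetSum _ fun i _ => (hL.comp (hc i)).smul continuous_const

theorem isCarlitzExp_toSep_iff {y x : KInfty k K} :
    IsCarlitzExp k (toSep k K y) (toSep k K x) ↔ carlitzExp k _ y = x := by
  have h : IsCarlitzExp k (toSep k K y) (toSep k K (carlitzExp k _ y)) := by
    have := isCarlitzExp_carlitzExp (k := k) y
    unfold IsCarlitzExp at *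
    convert this.map (toSep k K) continuous_toSep using 1
    funext i
    simp
  refine ⟨fun h' => toSep_injective (h.unique h'), ?_⟩
  rintro rfl
  exact h

/-- A point of `E(K)` lies in the kernel of the connecting map if and only if it is the
exponential of a point of `K_∞`. -/
theorem inConnectingKernel_iff {x : K} :
    InConnectingKernel k x ↔ ∃ y : KInfty k K, carlitzExp k _ y = KInfty.ofK k K x := by
  rw [InConnectingKernel.iff_exists]
  constructor
  · rintro ⟨y, l, hy, hl, h⟩
    obtain ⟨y', hy'⟩ := exists_toSep_eq_of_fixed (z := y - l) fun σ => by
      rw [map_sub, sub_eq_sub_iff_sub_eq_sub]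
      exact h σ
    refine ⟨y', isCarlitzExp_toSep_iff.mp ?_⟩
    rw [hy', toSep_ofK]
    simpa using hy.sub hl
  · rintro ⟨y, hy⟩
    refine ⟨toSep k K y, 0, ?_, IsCarlitzExp.zero, fun σ => ?_⟩
    · rw [← toSep_ofK]
      exact isCarlitzExp_toSep_iff.mpr hy
    · rw [galoisMap_toSep, map_zero, sub_self, sub_self]

end Descent

/-! ### Lattices in `K_∞` -/

section Lattice

open KInfty

variable {k : Type*} [Field k] [Fintype k] {K : Type*} [Field K] [Algebra (RatFunc k) K]
  [FunctionField k K]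

theorem polynomial_smul_eq (p : k[X]) (y : KInfty k K) :
    p • y = algebraMap (RatFunc k) (LaurentAtInfty k) (algebraMap k[X] (RatFunc k) p) • y := by
  rw [algebraMap_smul, algebraMap_smul]

theorem finite_of_norm_le {s : Set (KInfty k K)} (hs : ∀ x ∈ s, ∀ y ∈ s, ‖x - y‖ < 1 → x = y)
    {C : ℝ} (hC : ∀ x ∈ s, ‖x‖ ≤ C) : s.Finite := by
  obtain ⟨t, -, ht, hcov⟩ := finite_cover_balls_of_compact
    (isCompact_closedBall (0 : KInfty k K) C) zero_lt_one
  have h (x : KInfty k K) : ∃ c, x ∈ s → c ∈ t ∧ ‖x - c‖ < 1 := by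
    by_cases hx : x ∈ s
    · obtain ⟨c, hc, hxc⟩ := Set.mem_iUnion₂.mp
        (hcov (mem_closedBall_zero_iff.mpr (hC x hx)))
      exact ⟨c, fun _ => ⟨hc, by rwa [Metric.mem_ball, dist_eq_norm] at hxc⟩⟩
    · exact ⟨0, fun h => absurd h hx⟩
  choose c hc using h
  refine Set.Finite.of_injOn (f := c) (t := t) (fun x hx => (hc x hx).1) (fun x hx y hy e => ?_) ht
  refine hs x hx y hy ?_
  rw [← sub_add_sub_cancel x (c x) y]
  refine (IsUltrametricDist.norm_add_le_max _ _).trans_lt (max_lt (hc x hx).2 ?_)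
  rw [e, norm_sub_rev]
  exact (hc y hy).2

/-- The elements of a cocompact subgroup span `K_∞` over `k((1/t))`. -/
theorem exists_basis_of_cocompact {s : Set (KInfty k K)} {C : ℝ}
    (hC : ∀ a, ∃ m ∈ s, ‖a - m‖ ≤ C) :
    ∃ b : Module.Basis (Fin (Module.finrank (RatFunc k) K)) (LaurentAtInfty k) (KInfty k K),
      ∀ i, b i ∈ s := by
  obtain ⟨n, hn⟩ := pow_unbounded_of_one_lt C (one_lt_card (k := k))
  have hC0 : 0 ≤ C := by
    obtain ⟨m, -, hm⟩ := hC 0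
    exact (norm_nonneg _).trans hm
  choose m hm hmn using fun i => hC ((RatFunc.X ^ n : RatFunc k) • basis k K i)
  have hli : LinearIndependent (LaurentAtInfty k) m := by
    rw [Fintype.linearIndependent_iff]
    intro a ha
    set y : KInfty k K := (basis k K).equivFun.symm a with hy
    have hya : (basis k K).equivFun y = a := LinearEquiv.apply_symm_apply _ _
    -- the combination of the approximations differs from `t ^ n • y` by something small
    have e : (RatFunc.X ^ n : RatFunc k) • y =
        ∑ i, a i • ((RatFunc.X ^ n : RatFunc k) • basis k K i - m i) := by
      simp only [smul_sub, Finset.sum_sub_distrib, ha, sub_zero]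
      rw [hy, Module.Basis.equivFun_symm_apply, Finset.smul_sum]
      exact Finset.sum_congr rfl fun i _ => smul_comm _ _ _
    have h1 : ‖(RatFunc.X ^ n : RatFunc k) • y‖ ≤ C * ‖a‖ := by
      rw [e]
      refine IsUltrametricDist.norm_sum_le_of_forall_le_of_nonneg
        (mul_nonneg hC0 (norm_nonneg _)) fun i _ => ?_
      rw [norm_smul, mul_comm]
      exact mul_le_mul (hmn i) (norm_le_pi_norm a i) (norm_nonneg _) hC0
    rw [norm_ratFunc_smul, map_pow, norm_pow, norm_algebraMap_X, norm_def, hya] at h1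
    have h2 : ‖a‖ ≤ 0 := by
      by_contra h0
      rw [not_le] at h0
      rw [← mul_assoc] at h1
      have h3 := le_of_mul_le_mul_right h1 h0
      have h4 : (Fintype.card k : ℝ) ^ n ≤ (Fintype.card k : ℝ) ^ n * normConst k K :=
        le_mul_of_one_le_right (pow_nonneg card_pos.le _) one_le_normConst
      linarith
    exact fun i => congrFun (norm_le_zero_iff.mp h2) i
  have hcard := (Module.finrank_eq_card_basis (basis k K)).symm
  refine ⟨basisOfLinearIndependentOfCardEqFinrank' m hli hcard, fun i => ?_⟩
  rw [coe_basisOfLinearIndependentOfCardEqFinrank']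
  exact hm i

/-- A discrete and cocompact `k[t]`-submodule of `K_∞` is finitely generated of rank
`[K : k(t)]`. -/
theorem rank_eq_of_discrete_of_cocompact (M : Submodule k[X] (KInfty k K))
    (hd : ∀ m ∈ M, ‖m‖ < 1 → m = 0) {C : ℝ} (hC : ∀ a, ∃ m ∈ M, ‖a - m‖ ≤ C) :
    M.FG ∧ Module.rank k[X] M = (Module.finrank (RatFunc k) K : Cardinal) := by
  obtain ⟨b, hb⟩ := exists_basis_of_cocompact (s := (M : Set (KInfty k K))) hC
  set F : Set (KInfty k K) := {m | m ∈ M ∧ ‖m‖ ≤ ∑ i, ‖b i‖} with hF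
  have hFfin : F.Finite := finite_of_norm_le
    (fun x hx y hy h => sub_eq_zero.mp (hd _ (sub_mem hx.1 hy.1) h)) fun x hx => hx.2
  -- taking polynomial parts of coordinates moves an element of `M` into the finite set `F`
  have hfloor (m) (hm : m ∈ M) : ∃ m' ∈ Submodule.span k[X] (Set.range b), m - m' ∈ F := by
    choose p hp using fun i => exists_polynomial_norm_sub_lt_one (b.repr m i)
    refine ⟨∑ i, p i • b i, sum_mem fun i _ => Submodule.smul_mem _ _
      (Submodule.subset_span ⟨i, rfl⟩), sub_mem hm (sum_mem fun i _ => M.smul_mem _ (hb i)), ?_⟩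
    nth_rewrite 1 [← b.sum_repr m]
    simp only [polynomial_smul_eq, ← Finset.sum_sub_distrib, ← sub_smul]
    refine IsUltrametricDist.norm_sum_le_of_forall_le_of_nonneg
      (Finset.sum_nonneg fun _ _ => norm_nonneg _) fun i _ => ?_
    rw [norm_smul]
    exact (mul_le_of_le_one_left (norm_nonneg _) (hp i).le).trans
      (Finset.single_le_sum (f := fun i => ‖b i‖) (fun _ _ => norm_nonneg _) (Finset.mem_univ i))
  have hspan : Submodule.span k[X] (Set.range b) ≤ M :=
    Submodule.span_le.mpr (Set.range_subset_iff.mpr hb)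
  refine ⟨?_, ?_⟩
  · have e : M = Submodule.span k[X] (Set.range b ∪ F) := by
      refine le_antisymm (fun m hm => ?_) (Submodule.span_le.mpr (Set.union_subset
        (Set.range_subset_iff.mpr hb) fun m hm => hm.1))
      obtain ⟨m', hm', h⟩ := hfloor m hm
      rw [← sub_add_cancel m m']
      exact add_mem (Submodule.subset_span (Or.inr h))
        (Submodule.span_mono Set.subset_union_left hm')
    rw [e]
    exact Submodule.fg_span ((Set.finite_range b).union hFfin)
  · have hli : LinearIndependent k[X] b := by
      rw [LinearIndependent.iff_fractionRing (R := k[X]) (K := RatFunc k)]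
      exact b.linearIndependent.restrict_scalars fun x y h =>
        (algebraMap (RatFunc k) (LaurentAtInfty k)).injective
          (by simpa [Algebra.smul_def] using h)
    set N := (Submodule.span k[X] (Set.range b)).submoduleOf M with hN
    have h1 : Module.rank k[X] N = (Module.finrank (RatFunc k) K : Cardinal) := by
      rw [(Submodule.submoduleOfEquivOfLe hspan).rank_eq, rank_span hli,
        ← Nat.cast_card, Nat.card_range_of_injective b.injective, Nat.card_fin]
    have h2 : Module.rank k[X] (M ⧸ N) = 0 := by
      rw [rank_eq_zero_iff]
      intro x
      obtain ⟨m, rfl⟩ := N.mkQ_surjective x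
      choose f hf hf' using fun n : ℕ => hfloor ((Polynomial.X ^ n : k[X]) • m.1)
        (M.smul_mem _ m.2)
      have : Finite F := hFfin
      obtain ⟨n, n', hne, h⟩ := Finite.exists_ne_map_eq_of_infinite
        fun n : ℕ => (⟨_, hf' n⟩ : F)
      refine ⟨Polynomial.X ^ n - Polynomial.X ^ n', ?_, ?_⟩
      · rw [sub_ne_zero]
        exact fun h => hne (by simpa using congrArg Polynomial.natDegree h)
      · rw [← map_smul, Submodule.mkQ_apply, Submodule.Quotient.mk_eq_zero, hN]
        have e := Subtype.ext_iff.mp h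
        have e' : (((Polynomial.X ^ n - Polynomial.X ^ n' : k[X]) • m : M) : KInfty k K) =
            f n - f n' := by
          rw [Submodule.coe_smul, sub_smul]
          exact sub_eq_sub_iff_sub_eq_sub.mp e
        change (((Polynomial.X ^ n - Polynomial.X ^ n' : k[X]) • m : M) : KInfty k K) ∈
          Submodule.span k[X] (Set.range b)
        rw [e']
        exact sub_mem (hf n) (hf n')
    rw [← rank_quotient_add_rank_of_isDomain N, h1, h2, zero_add]

/-! ### The ring of integers in `K_∞` -/

variable [Algebra k[X] K] [IsScalarTower k[X] (RatFunc k) K]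

/-- The ring of integers is discrete: the norm of a small integral element is a polynomial of
absolute value less than `1`. -/
theorem eq_zero_of_isIntegral_of_norm_lt_one {x : K} (hx : IsIntegral k[X] x)
    (h : ‖ofK k K x‖ < 1) : x = 0 := by
  obtain ⟨p, hp⟩ := IsIntegrallyClosed.isIntegral_iff.mp
    (Algebra.isIntegral_norm (RatFunc k) hx)
  let b := Module.finBasis (RatFunc k) K
  have hentry (i j) : ‖algebraMap (RatFunc k) (LaurentAtInfty k) (Algebra.leftMulMatrix b x i j)‖ ≤
      ‖ofK k K x‖ := by
    rw [Algebra.leftMulMatrix_eq_repr_mul, ← repr_ofK, map_mul, ← basis_apply]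
    refine (norm_repr_le _ i).trans ?_
    rw [div_le_iff₀ normConst_pos, ← norm_basis j]
    exact norm_mul_le _ _
  have hp1 : p = 0 := by
    refine eq_zero_of_norm_algebraMap_polynomial_lt_one ?_
    rw [hp, Algebra.norm_eq_matrix_det b, Matrix.det_apply, map_sum]
    refine lt_of_le_of_lt ?_ h
    refine IsUltrametricDist.norm_sum_le_of_forall_le_of_nonneg (norm_nonneg _) fun σ _ => ?_
    have hs : ‖algebraMap (RatFunc k) (LaurentAtInfty k) (Equiv.Perm.sign σ •
        ∏ i, Algebra.leftMulMatrix b x (σ i) i)‖ = ∏ i, ‖algebraMap (RatFunc k) (LaurentAtInfty k)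
          (Algebra.leftMulMatrix b x (σ i) i)‖ := by
      rw [← norm_prod, ← map_prod]
      rcases Int.units_eq_one_or (Equiv.Perm.sign σ) with h | h <;> simp [h]
    rw [hs]
    refine (Finset.prod_le_prod (fun _ _ => norm_nonneg _) fun i _ => hentry (σ i) i).trans ?_
    rw [Finset.prod_const]
    refine pow_le_of_le_one (norm_nonneg _) h.le ?_
    rw [Finset.card_univ, Fintype.card_fin]
    exact Module.finrank_pos.ne'
  rw [hp1, map_zero] at hp
  exact Algebra.norm_eq_zero_iff.mp hp.symm

/-- The ring of integers is cocompact. -/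
theorem exists_isIntegral_norm_sub_le : ∃ C : ℝ, 0 ≤ C ∧ ∀ a : KInfty k K, ∃ x : K,
    IsIntegral k[X] x ∧ ‖a - ofK k K x‖ ≤ C := by
  classical
  obtain ⟨p, hp0, hp⟩ := exists_integral_multiples k[X] (RatFunc k)
    (Finset.univ.image (Module.finBasis (RatFunc k) K))
  set P : LaurentAtInfty k := algebraMap (RatFunc k) (LaurentAtInfty k)
    (algebraMap k[X] (RatFunc k) p) with hP
  have hP0 : P ≠ 0 := (map_ne_zero _).mpr (RatFunc.algebraMap_ne_zero hp0)
  refine ⟨‖P‖ * normConst k K, mul_nonneg (norm_nonneg _) normConst_pos.le, fun a => ?_⟩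
  choose f hf using fun i => exists_polynomial_norm_sub_lt_one ((basis k K).repr a i / P)
  refine ⟨∑ i, f i • p • Module.finBasis (RatFunc k) K i, ?_, ?_⟩
  · refine IsIntegral.sum _ fun i _ => IsIntegral.smul _ (hp _ ?_)
    exact Finset.mem_image_of_mem _ (Finset.mem_univ i)
  · have e : a - ofK k K (∑ i, f i • p • Module.finBasis (RatFunc k) K i) =
        ∑ i, (P * ((basis k K).repr a i / P - algebraMap (RatFunc k) (LaurentAtInfty k)
          (algebraMap k[X] (RatFunc k) (f i)))) • basis k K i := by
      nth_rewrite 1 [← (basis k K).sum_repr a]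
      rw [map_sum, ← Finset.sum_sub_distrib]
      refine Finset.sum_congr rfl fun i _ => ?_
      rw [mul_sub, mul_div_cancel₀ _ hP0, sub_smul, basis_apply, mul_comm P, mul_smul, hP,
        ← polynomial_smul_eq, ← polynomial_smul_eq, ← algebraMap_smul (RatFunc k) (f i),
        ← algebraMap_smul (RatFunc k) p, map_smul, map_smul, algebraMap_smul, algebraMap_smul]
    rw [e]
    refine IsUltrametricDist.norm_sum_le_of_forall_le_of_nonneg
      (mul_nonneg (norm_nonneg _) normConst_pos.le) fun i _ => ?_
    rw [norm_smul, norm_basis, norm_mul]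
    refine mul_le_mul_of_nonneg_right ?_ normConst_pos.le
    exact mul_le_of_le_one_right (norm_nonneg _) (hf i).le

end Lattice

/-! ### Logarithms of integral points -/

section Rank

open KInfty

/-- An additive map between `k[t]`-modules that commutes with constants and with `t` is
`k[t]`-linear. -/
def linearMapOfCommX {k M N : Type*} [Field k] [AddCommGroup M] [Module k[X] M] [AddCommGroup N]
    [Module k[X] N] (f : M →+ N)
    (hC : ∀ (c : k) (m : M), f ((Polynomial.C c : k[X]) • m) = (Polynomial.C c : k[X]) • f m)
    (hX : ∀ m : M, f ((Polynomial.X : k[X]) • m) = (Polynomial.X : k[X]) • f m) :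
    M →ₗ[k[X]] N where
  toFun := f
  map_add' := map_add f
  map_smul' p m := by
    simp only [RingHom.id_apply]
    induction p using Polynomial.induction_on generalizing m with
    | C a => exact hC a m
    | add p q hp hq => rw [add_smul, add_smul, map_add, hp, hq]
    | monomial n a ih => rw [pow_succ, ← mul_assoc, mul_smul, ih, hX, mul_smul _ Polynomial.X]

variable {k : Type*} [Field k] {K : Type*} [Field K] [Algebra (RatFunc k) K]

theorem X_smul_eq (y : KInfty k K) : (Polynomial.X : k[X]) • y = (RatFunc.X : RatFunc k) • y := by
  rw [← algebraMap_smul (RatFunc k), RatFunc.algebraMap_X]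

theorem C_smul_eq (c : k) (y : KInfty k K) :
    (Polynomial.C c : k[X]) • y = algebraMap k (RatFunc k) c • y := by
  rw [← algebraMap_smul (RatFunc k), ← Polynomial.algebraMap_eq,
    ← IsScalarTower.algebraMap_apply]

theorem ofK_polynomial_smul [Algebra k[X] K] [IsScalarTower k[X] (RatFunc k) K] (p : k[X]) (x : K) :
    ofK k K (p • x) = p • ofK k K x := by
  rw [← algebraMap_smul (RatFunc k) p x, map_smul, algebraMap_smul]

variable [Fintype k] [FunctionField k K]

variable (k K) in
/-- The exponential as a `k[t]`-linear map from the additive group of `K_∞`, on which `t` acts by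
multiplication, to the Carlitz module. -/
def carlitzExpLinear : KInfty k K →ₗ[k[X]] CarlitzPoints k (KInfty k K) :=
  linearMapOfCommX ((Module.AEval'.of (carlitzEnd k (KInfty k K))).toAddMonoidHom.comp
      (carlitzExp k (KInfty k K)))
    (fun c y => by
      rw [Module.AEval.C_smul, C_smul_eq]
      change Module.AEval'.of _ (carlitzExp k _ _) = c • Module.AEval'.of _ (carlitzExp k _ y)
      rw [carlitzExp_const_smul, algebraMap_smul, map_smul])
    (fun y => by
      rw [X_smul_eq]
      change Module.AEval'.of _ (carlitzExp k _ _) =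
        (Polynomial.X : k[X]) • Module.AEval'.of _ (carlitzExp k _ y)
      rw [carlitzExp_X_smul, Module.AEval'.X_smul_of, ← X_smul_eq, Algebra.smul_def]
      rfl)

variable (k K) in
/-- The lattice of periods `Λ_E ∩ K_∞`. -/
def periodLattice : Submodule k[X] (KInfty k K) := LinearMap.ker (carlitzExpLinear k K)

theorem mem_periodLattice {y : KInfty k K} : y ∈ periodLattice k K ↔ carlitzExp k _ y = 0 :=
  Iff.rfl

variable [Algebra k K] [Algebra k[X] K] [IsScalarTower k k[X] K] [IsScalarTower k[X] (RatFunc k) K]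

variable (k K) in
/-- The map `E(R) → E(K_∞)`. -/
def integersMap : CarlitzPoints k (FunctionField.ringOfIntegers k K) →ₗ[k[X]]
    CarlitzPoints k (KInfty k K) :=
  linearMapOfCommX
    { toFun := fun x => Module.AEval'.of _ (ofK k K
        ((Module.AEval'.of _).symm x : FunctionField.ringOfIntegers k K))
      map_zero' := by simp
      map_add' := fun x y => by simp }
    (fun c x => by
      change Module.AEval'.of _ (ofK k K ((Module.AEval'.of _).symm (_ • x) :
        FunctionField.ringOfIntegers k K)) = (Polynomial.C c : k[X]) • Module.AEval'.of _ _
      rw [Module.AEval.C_smul, Module.AEval.C_smul,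
        (Module.AEval'.of (carlitzEnd k (FunctionField.ringOfIntegers k K))).symm.map_smul,
        ← (Module.AEval'.of (carlitzEnd k (KInfty k K))).map_smul]
      congr 1
      have e (z : FunctionField.ringOfIntegers k K) :
          ((c • z : FunctionField.ringOfIntegers k K) : K) = (Polynomial.C c : k[X]) • (z : K) := by
        rw [← Polynomial.algebraMap_eq, algebraMap_smul]
        rfl
      rw [e, ofK_polynomial_smul, ← Polynomial.algebraMap_eq, algebraMap_smul])
    (fun x => by
      change Module.AEval'.of _ (ofK k K ((Module.AEval'.of _).symm (_ • x) :
        FunctionField.ringOfIntegers k K)) = (Polynomial.X : k[X]) • Module.AEval'.of _ _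
      rw [Module.AEval'.of_symm_X_smul, Module.AEval'.X_smul_of]
      congr 1
      have e (z : FunctionField.ringOfIntegers k K) :
          ((carlitzEnd k _ z : FunctionField.ringOfIntegers k K) : K) =
            (Polynomial.X : k[X]) • (z : K) + (z : K) ^ Fintype.card k := by
        rw [Algebra.smul_def]
        rfl
      rw [e, map_add, map_pow, ofK_polynomial_smul, Algebra.smul_def]
      rfl)

omit [FunctionField k K] in
theorem integersMap_apply (x : CarlitzPoints k (FunctionField.ringOfIntegers k K)) :
    integersMap k K x = Module.AEval'.of _ (ofK k K
      ((Module.AEval'.of _).symm x : FunctionField.ringOfIntegers k K)) := rfl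

theorem integersMap_injective : Function.Injective (integersMap k K) := by
  intro x y h
  rw [integersMap_apply, integersMap_apply] at h
  exact (Module.AEval'.of _).symm.injective
    (Subtype.ext (ofK_injective ((Module.AEval'.of _).injective h)))

theorem mem_carlitzUnits_iff {x : CarlitzPoints k (FunctionField.ringOfIntegers k K)} :
    x ∈ carlitzUnits k K ↔ integersMap k K x ∈ LinearMap.range (carlitzExpLinear k K) := by
  change InConnectingKernel k _ ↔ _
  rw [inConnectingKernel_iff, LinearMap.mem_range]
  exact Iff.rfl

variable (k K) in
/-- The points of `K_∞` whose exponential is a point of `E(R)`. -/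
def logLattice : Submodule k[X] (KInfty k K) :=
  (LinearMap.range (integersMap k K)).comap (carlitzExpLinear k K)

theorem mem_logLattice {y : KInfty k K} :
    y ∈ logLattice k K ↔ ∃ x : K, IsIntegral k[X] x ∧ carlitzExp k _ y = ofK k K x := by
  constructor
  · rintro ⟨x, hx⟩
    exact ⟨_, ((Module.AEval'.of _).symm x : FunctionField.ringOfIntegers k K).2, hx.symm⟩
  · rintro ⟨x, hx, h⟩
    exact ⟨Module.AEval'.of _ ⟨x, hx⟩, h.symm⟩

theorem periodLattice_le : periodLattice k K ≤ logLattice k K := fun y hy =>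
  mem_logLattice.mpr ⟨0, isIntegral_zero, by rw [map_zero]; exact hy⟩

theorem eq_zero_of_mem_logLattice {y : KInfty k K} (hy : y ∈ logLattice k K) (h : ‖y‖ < 1) :
    y = 0 := by
  obtain ⟨x, hx, e⟩ := mem_logLattice.mp hy
  have hn : ‖carlitzExp k _ y‖ = ‖y‖ := norm_additiveSeries _ h.le
  have hx0 := eq_zero_of_isIntegral_of_norm_lt_one hx (by rwa [← e, hn])
  rwa [e, hx0, map_zero, norm_zero, eq_comm, norm_eq_zero] at hn

/-- The lattice `logLattice` is cocompact because `E(K_∞) / E(R)` is compact and the exponential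
is surjective near `0`. -/
theorem exists_mem_logLattice_norm_sub_le :
    ∃ C : ℝ, ∀ a, ∃ m ∈ logLattice k K, ‖a - m‖ ≤ C := by
  obtain ⟨C, hC0, hC⟩ := exists_isIntegral_norm_sub_le (k := k) (K := K)
  obtain ⟨s, -, hs, hcov⟩ := finite_cover_balls_of_compact
    (isCompact_closedBall (0 : KInfty k K) C) zero_lt_one
  -- one representative `g c` for each of the finitely many balls covering `closedBall 0 C`
  have hrep (c : KInfty k K) : ∃ g : KInfty k K, (∃ (a : KInfty k K) (x : K), IsIntegral k[X] x ∧
      carlitzExp k _ a - ofK k K x ∈ Metric.ball c 1) → ∃ x : K, IsIntegral k[X] x ∧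
        carlitzExp k _ g - ofK k K x ∈ Metric.ball c 1 := by
    by_cases h : ∃ (a : KInfty k K) (x : K), IsIntegral k[X] x ∧
      carlitzExp k _ a - ofK k K x ∈ Metric.ball c 1
    · exact ⟨h.choose, fun _ => h.choose_spec⟩
    · exact ⟨0, fun h' => absurd h' h⟩
  choose g hg using hrep
  obtain ⟨D, hD⟩ := (hs.image fun c => ‖g c‖).bddAbove
  refine ⟨max D 1, fun a => ?_⟩
  obtain ⟨x, hx, hax⟩ := hC (carlitzExp k _ a)
  obtain ⟨c, hcs, hc⟩ := Set.mem_iUnion₂.mp (hcov (mem_closedBall_zero_iff.mpr hax))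
  obtain ⟨x', hx', hc'⟩ := hg c ⟨a, x, hx, hc⟩
  rw [Metric.mem_ball, dist_eq_norm] at hc hc'
  have hd : ‖carlitzExp k _ a - ofK k K x - (carlitzExp k _ (g c) - ofK k K x')‖ ≤ 1 := by
    rw [← sub_sub_sub_cancel_right _ _ c]
    exact (norm_sub_le_max_of_isUltrametricDist _ _).trans (max_le hc.le hc'.le)
  obtain ⟨y, hy1, hy⟩ := exists_additiveSeries_eq (isEntireCoeff_carlitzCoeff k) le_rfl hd
  refine ⟨a - g c - y, mem_logLattice.mpr ⟨x - x', hx.sub hx', ?_⟩, ?_⟩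
  · rw [map_sub, map_sub, map_sub]
    rw [show carlitzExp k _ y = _ from hy]
    abel
  · rw [show a - (a - g c - y) = g c + y by abel]
    exact (IsUltrametricDist.norm_add_le_max _ _).trans
      (max_le_max (hD (Set.mem_image_of_mem _ hcs)) hy1)

theorem logLattice_fg_rank : (logLattice k K).FG ∧
    Module.rank k[X] (logLattice k K) = (Module.finrank (RatFunc k) K : Cardinal) := by
  obtain ⟨C, hC⟩ := exists_mem_logLattice_norm_sub_le (k := k) (K := K)
  exact rank_eq_of_discrete_of_cocompact _ (fun _ hm h => eq_zero_of_mem_logLattice hm h) hC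

variable (k K) in
theorem finite_periodLattice : Module.Finite k[X] (periodLattice k K) := by
  have : Module.Finite k[X] (logLattice k K) := Module.Finite.iff_fg.mpr logLattice_fg_rank.1
  exact Module.Finite.equiv (Submodule.submoduleOfEquivOfLe periodLattice_le)

/-- The exact sequence `0 → Λ_E ∩ K_∞ → logLattice → U_R → 0` computes the rank of `U_R`. -/
theorem rank_carlitzUnits_add_finrank_periodLattice :
    Module.rank k[X] (carlitzUnits k K) + (Module.finrank k[X] (periodLattice k K) : Cardinal) =
      (Module.finrank (RatFunc k) K : Cardinal) := by
  have : Module.Finite k[X] (periodLattice k K) := finite_periodLattice k K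
  let f := (carlitzExpLinear k K).domRestrict (logLattice k K)
  have h1 := LinearMap.rank_range_add_rank_ker f
  have hker : Module.rank k[X] (LinearMap.ker f) = (Module.finrank k[X] (periodLattice k K) :
      Cardinal) := by
    rw [Module.finrank_eq_rank, LinearMap.ker_domRestrict]
    exact (Submodule.submoduleOfEquivOfLe periodLattice_le).rank_eq
  have hrange : LinearMap.range f = (carlitzUnits k K).map (integersMap k K) := by
    rw [LinearMap.range_domRestrict]
    ext z
    constructor
    · rintro ⟨y, ⟨x, hx⟩, rfl⟩
      exact ⟨x, mem_carlitzUnits_iff.mpr ⟨y, hx.symm⟩, hx⟩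
    · rintro ⟨x, hx, rfl⟩
      obtain ⟨y, hy⟩ := mem_carlitzUnits_iff.mp hx
      exact ⟨y, ⟨x, hy.symm⟩, hy⟩
  have h2 := ((carlitzUnits k K).equivMapOfInjective _ integersMap_injective).lift_rank_eq
  rw [hker, logLattice_fg_rank.2, hrange] at h1
  obtain ⟨n, hn⟩ := Cardinal.lt_aleph0.mp
    ((self_le_add_right _ _).trans_lt (h1.trans_lt Cardinal.natCast_lt_aleph0))
  rw [hn, Cardinal.lift_natCast, Cardinal.lift_eq_nat_iff] at h2
  rw [hn] at h1
  rw [h2]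
  exact_mod_cast h1

end Rank

/-! ### Periods and `t`-torsion -/

section Torsion

open KInfty

variable {k : Type*} [Field k] [Fintype k] {K : Type*} [Field K] [Algebra (RatFunc k) K]
  [FunctionField k K]

instance : Module.IsTorsionFree k[X] (KInfty k K) :=
  Module.IsTorsionFree.of_smul_eq_zero fun p y h => by
    rw [← algebraMap_smul (RatFunc k)] at h
    refine (smul_eq_zero.mp h).imp_left fun h => ?_
    exact (map_eq_zero_iff _ (RatFunc.algebraMap_injective k)).mp h

variable (k K) in
/-- The `t`-torsion of the Carlitz module on `K_∞`. -/
def torsion : Submodule k (KInfty k K) := LinearMap.ker (carlitzEnd k (KInfty k K))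

omit [FunctionField k K] in
theorem mem_torsion {τ : KInfty k K} :
    τ ∈ torsion k K ↔ (RatFunc.X : RatFunc k) • τ + τ ^ Fintype.card k = 0 := by
  rw [← X_smul_eq, Algebra.smul_def]
  exact Iff.rfl

omit [FunctionField k K] in
theorem pow_card_eq_of_mem_torsion {τ : KInfty k K} (h : τ ∈ torsion k K) :
    τ ^ Fintype.card k = -((RatFunc.X : RatFunc k) • τ) :=
  eq_neg_of_add_eq_zero_right (mem_torsion.mp h)

theorem carlitzExp_smul (c : k) (y : KInfty k K) :
    carlitzExp k (KInfty k K) (c • y) = c • carlitzExp k _ y := by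
  have := carlitzExp_const_smul c y
  rwa [algebraMap_smul, algebraMap_smul] at this

theorem X_smul_mem_periodLattice_iff {z : KInfty k K} :
    (RatFunc.X : RatFunc k) • z ∈ periodLattice k K ↔ carlitzExp k _ z ∈ torsion k K := by
  rw [mem_periodLattice, carlitzExp_X_smul, mem_torsion]

/-- The map `λ ↦ exp (λ / t)` identifies the reduction of the period lattice modulo `t` with the
`t`-torsion. -/
theorem rank_torsion [Module.Finite k[X] (periodLattice k K)] :
    Module.rank k (torsion k K) = (Module.finrank k[X] (periodLattice k K) : Cardinal) := by
  let b := Module.finBasis k[X] (periodLattice k K)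
  have hX : (RatFunc.X : RatFunc k) ≠ 0 := RatFunc.X_ne_zero
  have hτ (i) : carlitzExp k _ ((RatFunc.X : RatFunc k)⁻¹ • (b i : KInfty k K)) ∈ torsion k K := by
    rw [← X_smul_mem_periodLattice_iff, smul_inv_smul₀ hX]
    exact (b i).2
  let τ : Fin (Module.finrank k[X] (periodLattice k K)) → torsion k K := fun i => ⟨_, hτ i⟩
  have hli : LinearIndependent k τ := by
    rw [Fintype.linearIndependent_iff]
    intro c hc i
    have h0 : carlitzExp k _ ((RatFunc.X : RatFunc k)⁻¹ •
        ((∑ j, Polynomial.C (c j) • b j : periodLattice k K) : KInfty k K)) = 0 := by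
      have := congrArg Subtype.val hc
      simp only [τ, Submodule.coe_sum, Submodule.coe_smul, Submodule.coe_zero] at this
      rw [← this, Submodule.coe_sum, Finset.smul_sum, map_sum]
      refine Finset.sum_congr rfl fun j _ => ?_
      rw [Submodule.coe_smul, ← carlitzExp_smul, ← Polynomial.algebraMap_eq, algebraMap_smul,
        smul_comm]
    have h1 : (∑ j, Polynomial.C (c j) • b j : periodLattice k K) =
        (Polynomial.X : k[X]) • (⟨_, mem_periodLattice.mpr h0⟩ : periodLattice k K) := by
      refine Subtype.ext ?_
      rw [Submodule.coe_smul, X_smul_eq, smul_inv_smul₀ hX]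
    have h2 := congrArg (fun y => b.repr y i) h1
    simp only [Module.Basis.repr_sum_self, map_smul, Finsupp.smul_apply, smul_eq_mul] at h2
    simpa using congrArg (fun p => Polynomial.coeff p 0) h2
  have hspan : ⊤ ≤ Submodule.span k (Set.range τ) := by
    rintro ⟨σ, hσ⟩ -
    obtain ⟨z, hz⟩ := exists_carlitzExp_eq_of_torsion (pow_card_eq_of_mem_torsion hσ)
    have hz' : (RatFunc.X : RatFunc k) • z ∈ periodLattice k K := by
      rwa [X_smul_mem_periodLattice_iff, hz]
    obtain ⟨p, hp⟩ : ∃ p : Fin _ → k[X],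
      ∑ i, p i • b i = (⟨_, hz'⟩ : periodLattice k K) := ⟨_, b.sum_repr _⟩
    have e : (⟨σ, hσ⟩ : torsion k K) = ∑ i, (p i).coeff 0 • τ i := by
      refine Subtype.ext ?_
      simp only [τ, Submodule.coe_sum, Submodule.coe_smul, ← carlitzExp_smul]
      rw [← map_sum, ← hz, ← sub_eq_zero, ← map_sub, ← mem_periodLattice]
      have h1 := congrArg Subtype.val hp
      rw [Submodule.coe_sum] at h1
      rw [← inv_smul_smul₀ hX z]
      change _ = (RatFunc.X : RatFunc k) • z at h1
      rw [← h1, Finset.smul_sum, ← Finset.sum_sub_distrib]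
      refine sum_mem fun i _ => ?_
      have h2 : (RatFunc.X : RatFunc k)⁻¹ • ((p i • b i : periodLattice k K) :
          KInfty k K) - (p i).coeff 0 • (RatFunc.X : RatFunc k)⁻¹ • (b i : KInfty k K)
          = (p i).divX • (b i : KInfty k K) := by
        have h3 := Polynomial.X_mul_divX_add (p i)
        conv_lhs => rw [← h3]
        simp only [Polynomial.coeff_add, Polynomial.mul_coeff_zero, Polynomial.coeff_X_zero,
          zero_mul, Polynomial.coeff_C_zero, zero_add]
        rw [Submodule.coe_smul, add_smul, mul_smul, X_smul_eq, smul_add, inv_smul_smul₀ hX,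
          ← Polynomial.algebraMap_eq, algebraMap_smul, smul_comm, add_sub_cancel_right]
      rw [h2]
      exact Submodule.smul_mem _ _ (b i).2
    rw [e]
    exact sum_mem fun i _ => Submodule.smul_mem _ _ (Submodule.subset_span ⟨i, rfl⟩)
  have := (Module.Basis.mk hli hspan).mk_eq_rank
  rw [Cardinal.mk_fin, Cardinal.lift_natCast, eq_comm, Cardinal.lift_eq_nat_iff] at this
  exact this

end Torsion

/-! ### Places above infinity -/

section Places

open KInfty Filter Topology

variable {k : Type*} [Field k] [Fintype k] {K : Type*} [Field K] [Algebra (RatFunc k) K]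

namespace PlaceAboveInfty

/-- The valuation of a place, written multiplicatively, with values in its own value group. -/
abbrev val (v : PlaceAboveInfty k K) : Valuation K v.1.ValueGroup := v.1.valuation

variable (k K) in
/-- The element `t` of `K`. -/
abbrev tElt : K := algebraMap (RatFunc k) K RatFunc.X

variable (v : PlaceAboveInfty k K)

omit [Fintype k] in
theorem one_lt_val_t : 1 < v.val (tElt k K) := by
  rw [← not_le, ValuationSubring.valuation_le_one_iff]
  exact v.2

theorem val_const {c : k} (hc : c ≠ 0) :
    v.val (algebraMap (RatFunc k) K (algebraMap k (RatFunc k) c)) = 1 := by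
  have h : v.val (algebraMap (RatFunc k) K (algebraMap k (RatFunc k) c)) ^ (Fintype.card k - 1) =
      1 := by
    rw [← map_pow, ← map_pow, ← map_pow, FiniteField.pow_card_sub_one_eq_one c hc, map_one, map_one,
      map_one]
  have hn : Fintype.card k - 1 ≠ 0 := (Nat.sub_pos_of_lt Fintype.one_lt_card).ne'
  rcases lt_trichotomy (v.val (algebraMap (RatFunc k) K (algebraMap k (RatFunc k) c))) 1 with
    h1 | h1 | h1
  · exact absurd h (pow_lt_one₀ zero_le h1 hn).ne
  · exact h1
  · exact absurd h (one_lt_pow₀ h1 hn).ne'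

theorem val_polynomial {p : k[X]} (hp : p ≠ 0) :
    v.val (algebraMap (RatFunc k) K (algebraMap k[X] (RatFunc k) p)) =
      v.val (tElt k K) ^ p.natDegree := by
  induction hn : p.natDegree using Nat.strong_induction_on generalizing p with
  | _ n ih =>
    have hlead : v.val (algebraMap (RatFunc k) K (algebraMap k[X] (RatFunc k)
        (Polynomial.monomial n p.leadingCoeff))) = v.val (tElt k K) ^ n := by
      rw [← Polynomial.C_mul_X_pow_eq_monomial, map_mul, map_mul, map_pow, map_pow, map_mul,
        map_pow, RatFunc.algebraMap_X, ← Polynomial.algebraMap_eq,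
        ← IsScalarTower.algebraMap_apply k k[X] (RatFunc k),
        val_const v (Polynomial.leadingCoeff_ne_zero.mpr hp), one_mul]
    by_cases h0 : p.eraseLead = 0
    · rw [← hlead, ← hn]
      conv_lhs => rw [← p.eraseLead_add_monomial_natDegree_leadingCoeff, h0, zero_add]
    · have hlt : p.eraseLead.natDegree < n := by
        rw [← hn]
        exact p.eraseLead_natDegree_lt_or_eraseLead_eq_zero.resolve_right h0
      have h1 := ih _ hlt h0 rfl
      conv_lhs => rw [← p.eraseLead_add_monomial_natDegree_leadingCoeff, hn, map_add, map_add]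
      rw [Valuation.map_add_eq_of_lt_right, hlead]
      rw [hlead, h1]
      exact pow_lt_pow_right₀ v.one_lt_val_t hlt

theorem val_ratFunc {f : RatFunc k} (hf : f ≠ 0) :
    v.val (algebraMap (RatFunc k) K f) = v.val (tElt k K) ^ f.intDegree := by
  have h0 : v.val (tElt k K) ≠ 0 := (zero_lt_one.trans v.one_lt_val_t).ne'
  have hd : f.num ≠ 0 := RatFunc.num_ne_zero hf
  conv_lhs => rw [← RatFunc.num_div_denom f, map_div₀, map_div₀, val_polynomial v hd,
    val_polynomial v f.denom_ne_zero]
  rw [RatFunc.intDegree, zpow_sub₀ h0, zpow_natCast, zpow_natCast]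

theorem val_ratFunc_le_one {f : RatFunc k}
    (hf : ‖algebraMap (RatFunc k) (LaurentAtInfty k) f‖ ≤ 1) :
    v.val (algebraMap (RatFunc k) K f) ≤ 1 := by
  rcases eq_or_ne f 0 with rfl | h0
  · simp
  rw [norm_algebraMap h0, zpow_le_one_iff_right₀ one_lt_card] at hf
  rw [val_ratFunc v h0]
  exact zpow_le_one_of_nonpos₀ v.one_lt_val_t.le hf

theorem val_ratFunc_lt_one {f : RatFunc k}
    (hf : ‖algebraMap (RatFunc k) (LaurentAtInfty k) f‖ < 1) :
    v.val (algebraMap (RatFunc k) K f) < 1 := by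
  rcases eq_or_ne f 0 with rfl | h0
  · simp
  rw [norm_algebraMap h0, zpow_lt_one_iff_right₀ one_lt_card] at hf
  rw [val_ratFunc v h0]
  exact zpow_lt_one_of_neg₀ v.one_lt_val_t hf

variable [FunctionField k K]

variable {v} in
/-- An element of `K` that is small in `K_∞` is small at every place above infinity. -/
theorem val_lt_one_of_norm_lt_one {y : K} (hy : ‖ofK k K y‖ < 1) : v.val y < 1 := by
  -- multiplication by `y` decreases the largest value `v (b j)` of a basis vector
  let b := Module.finBasis (RatFunc k) K
  have hne : (Finset.univ : Finset (Fin (Module.finrank (RatFunc k) K))).Nonempty :=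
    ⟨⟨0, Module.finrank_pos⟩, Finset.mem_univ _⟩
  obtain ⟨j, -, hj⟩ := Finset.exists_max_image Finset.univ (fun i => v.val (b i)) hne
  have hj0 : v.val (b j) ≠ 0 := (Valuation.ne_zero_iff _).mpr (b.ne_zero j)
  have h : v.val (y * b j) < v.val (b j) := by
    rw [← b.sum_repr (y * b j)]
    refine Valuation.map_sum_lt _ hj0 fun i _ => ?_
    rw [Algebra.smul_def, map_mul]
    have hi : v.val (algebraMap (RatFunc k) K (b.repr (y * b j) i)) < 1 := by
      refine v.val_ratFunc_lt_one ?_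
      rw [← repr_ofK, map_mul, ← basis_apply]
      refine (norm_repr_le _ i).trans_lt ?_
      rw [div_lt_one normConst_pos]
      refine (norm_mul_le _ _).trans_lt ?_
      rw [norm_basis]
      exact mul_lt_of_lt_one_left normConst_pos hy
    exact (mul_le_mul_right (hj i (Finset.mem_univ i)) _).trans_lt
      (mul_lt_of_lt_one_left (zero_lt_iff.mpr hj0) hi)
  rw [map_mul] at h
  by_contra h1
  exact absurd h (not_lt.mpr (le_mul_of_one_le_left zero_le (not_lt.mp h1)))

theorem exists_val_lt_val_t_pow (y : K) : ∃ n : ℕ, v.val y < v.val (tElt k K) ^ n := by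
  obtain ⟨n, hn⟩ := pow_unbounded_of_one_lt ‖ofK k K y‖ (one_lt_card (k := k))
  have ht : v.val (tElt k K) ≠ 0 := (zero_lt_one.trans v.one_lt_val_t).ne'
  refine ⟨n, ?_⟩
  have h : v.val (((RatFunc.X : RatFunc k) ^ n)⁻¹ • y) < 1 := by
    refine val_lt_one_of_norm_lt_one ?_
    rw [map_smul, norm_ratFunc_smul, map_inv₀, map_pow, norm_inv, norm_pow, norm_algebraMap_X,
      inv_mul_lt_iff₀ (pow_pos card_pos n), mul_one]
    exact hn
  rwa [Algebra.smul_def, map_mul, map_inv₀, map_pow, map_inv₀, map_pow,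
    inv_mul_lt_iff₀ (pow_pos (zero_lt_iff.mpr ht) n), mul_one] at h

/-- If a finite sum vanishes, then two of its terms have the same value. -/
theorem _root_.Valuation.exists_ne_eq_of_sum_eq_zero {R Γ ι : Type*} [Ring R]
    [LinearOrderedCommGroupWithZero Γ] (ν : Valuation R Γ) {s : Finset ι} {f : ι → R}
    (h : ∑ i ∈ s, f i = 0) {i₀ : ι} (hi₀ : i₀ ∈ s) (h0 : ν (f i₀) ≠ 0) :
    ∃ i ∈ s, ∃ j ∈ s, i ≠ j ∧ ν (f i) = ν (f j) ∧ ν (f i) ≠ 0 := by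
  classical
  obtain ⟨i, hi, hmax⟩ := Finset.exists_max_image s (fun i => ν (f i)) ⟨i₀, hi₀⟩
  have hi0 : ν (f i) ≠ 0 := fun e => h0 (le_antisymm (e ▸ hmax i₀ hi₀) zero_le)
  by_contra! hcon
  have hlt : ν (∑ j ∈ s.erase i, f j) < ν (f i) := Valuation.map_sum_lt _ hi0 fun j hj =>
    lt_of_le_of_ne (hmax j (Finset.mem_of_mem_erase hj)) fun e =>
      hi0 (hcon i hi j (Finset.mem_of_mem_erase hj) (Finset.ne_of_mem_erase hj).symm e.symm)
  rw [← Finset.add_sum_erase s f hi, add_eq_zero_iff_neg_eq] at h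
  rw [← h, Valuation.map_neg] at hlt
  exact lt_irrefl _ hlt

/-- The value group is archimedean, because `K` is algebraic over `k(t)`. -/
theorem exists_val_t_le_pow {x : K} (hx : 1 < v.val x) :
    ∃ n : ℕ, v.val (tElt k K) ≤ v.val x ^ n := by
  have hx0 : v.val x ≠ 0 := (zero_lt_one.trans hx).ne'
  have ht0 : v.val (tElt k K) ≠ 0 := (zero_lt_one.trans v.one_lt_val_t).ne'
  have hint : IsIntegral (RatFunc k) x := Algebra.IsIntegral.isIntegral x
  have hsum := minpoly.aeval (RatFunc k) x
  rw [Polynomial.aeval_eq_sum_range] at hsum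
  obtain ⟨i, -, j, -, hij, h, h0⟩ := v.val.exists_ne_eq_of_sum_eq_zero hsum
    (Finset.self_mem_range_succ _) (by
      rw [Polynomial.coeff_natDegree, minpoly.monic hint, one_smul, map_pow]
      exact pow_ne_zero _ hx0)
  wlog hlt : i < j generalizing i j
  · exact this j i hij.symm h.symm (h ▸ h0) (lt_of_le_of_ne (not_lt.mp hlt) hij.symm)
  refine ⟨j - i, ?_⟩
  simp only [Algebra.smul_def, map_mul, map_pow] at h h0
  have hci : (minpoly (RatFunc k) x).coeff i ≠ 0 := fun e => h0 (by simp [e])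
  have hcj : (minpoly (RatFunc k) x).coeff j ≠ 0 := fun e => h0 (by rw [h]; simp [e])
  rw [v.val_ratFunc hci, v.val_ratFunc hcj] at h
  obtain ⟨m, rfl⟩ := Nat.exists_eq_add_of_lt hlt
  have e : v.val x ^ (i + m + 1 - i) = v.val (tElt k K) ^
      (((minpoly (RatFunc k) x).coeff i).intDegree -
        ((minpoly (RatFunc k) x).coeff (i + m + 1)).intDegree) := by
    rw [zpow_sub₀ ht0, eq_div_iff (zpow_ne_zero _ ht0)]
    refine mul_right_cancel₀ (pow_ne_zero i hx0) ?_
    rw [h, mul_comm, ← mul_assoc, ← pow_add, mul_comm]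
    congr 2
    lia
  have h1 : 1 < v.val x ^ (i + m + 1 - i) := one_lt_pow₀ hx (by lia)
  rw [e] at h1 ⊢
  rw [one_lt_zpow_iff_right₀ v.one_lt_val_t] at h1
  exact (zpow_one (v.val (tElt k K))).symm.le.trans (zpow_le_zpow_right₀ v.one_lt_val_t.le h1)

theorem exists_val_lt_pow {x : K} (hx : 1 < v.val x) (y : K) : ∃ n : ℕ, v.val y < v.val x ^ n := by
  obtain ⟨m, hm⟩ := v.exists_val_t_le_pow hx
  obtain ⟨n, hn⟩ := v.exists_val_lt_val_t_pow y
  refine ⟨m * n, hn.trans_le ?_⟩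
  rw [pow_mul]
  exact pow_le_pow_left₀ zero_le hm n

theorem exists_pow_mul_val_lt_one {x : K} (hx : v.val x < 1) (y : K) :
    ∃ N : ℕ, ∀ n, N ≤ n → v.val x ^ n * v.val y < 1 := by
  rcases eq_or_ne x 0 with rfl | h0
  · exact ⟨1, fun n hn => by simp [Nat.pos_iff_ne_zero.mp hn]⟩
  have hx0 : v.val x ≠ 0 := (Valuation.ne_zero_iff _).mpr h0
  obtain ⟨N, hN⟩ := v.exists_val_lt_pow (x := x⁻¹)
    (by rw [map_inv₀]; exact (one_lt_inv₀ (zero_lt_iff.mpr hx0)).mpr hx) y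
  refine ⟨N, fun n hn => ?_⟩
  rw [map_inv₀, inv_pow, ← one_div, lt_div_iff₀ (pow_pos (zero_lt_iff.mpr hx0) N), mul_comm] at hN
  exact (mul_le_mul_left (pow_le_pow_of_le_one zero_le hx.le hn) _).trans_lt hN

/-- Distinct places above infinity are incomparable. -/
theorem exists_le_one_one_lt {v w : PlaceAboveInfty k K} (h : v ≠ w) :
    ∃ x, v.val x ≤ 1 ∧ 1 < w.val x := by
  by_contra! hcon
  have hle : v.1 ≤ w.1 := fun x hx =>
    (w.1.valuation_le_one_iff x).mp (hcon x ((v.1.valuation_le_one_iff x).mpr hx))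
  refine h (Subtype.ext (le_antisymm hle fun x hx => ?_))
  by_contra hxv
  rw [← ValuationSubring.valuation_le_one_iff, not_le] at hxv
  obtain ⟨n, hn⟩ := v.exists_val_t_le_pow hxv
  have hx0 : x ≠ 0 := by
    rintro rfl
    exact hxv.not_ge (by simp)
  have h1 : v.val (tElt k K / x ^ n) ≤ 1 := by
    rw [map_div₀, map_pow]
    exact div_le_one_of_le₀ hn zero_le
  refine w.2 ?_
  have h2 := w.1.mul_mem _ _ (hle ((v.1.valuation_le_one_iff _).mp h1)) (pow_mem hx n)
  rwa [div_mul_cancel₀ _ (pow_ne_zero n hx0)] at h2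

theorem exists_one_lt_lt_one (S : Finset (PlaceAboveInfty k K)) {v : PlaceAboveInfty k K}
    (hv : v ∉ S) : ∃ a, 1 < v.val a ∧ ∀ w ∈ S, w.val a < 1 := by
  classical
  induction S using Finset.induction_on with
  | empty => exact ⟨tElt k K, v.one_lt_val_t, by simp⟩
  | insert w S hw ih =>
    rw [Finset.mem_insert, not_or] at hv
    obtain ⟨a, ha, haS⟩ := ih hv.2
    obtain ⟨x, hx, hx'⟩ := exists_le_one_one_lt hv.1
    obtain ⟨y, hy, hy'⟩ := exists_le_one_one_lt (Ne.symm hv.1)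
    set b := y / x with hb
    have hbv : 1 < v.val b := by
      have hx0 : 0 < v.val x := by
        rw [zero_lt_iff, Valuation.ne_zero_iff]
        rintro rfl
        exact hx'.not_ge (by simp)
      rw [hb, map_div₀, one_lt_div₀ hx0]
      exact hx.trans_lt hy'
    have hbw : w.val b < 1 := by
      rw [hb, map_div₀, div_lt_one₀ (zero_lt_one.trans hx')]
      exact hy.trans_lt hx'
    have hN (u : PlaceAboveInfty k K) : ∃ N : ℕ, u ∈ S → ∀ n, N ≤ n →
        u.val a ^ n * u.val b < 1 := by
      by_cases hu : u ∈ S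
      · obtain ⟨N, hN⟩ := u.exists_pow_mul_val_lt_one (haS u hu) b
        exact ⟨N, fun _ => hN⟩
      · exact ⟨0, fun h => absurd h hu⟩
    choose N hN using hN
    set n := S.sup N with hn
    rcases le_or_gt (w.val a) 1 with hwa | hwa
    · refine ⟨a ^ n * b, ?_, fun u hu => ?_⟩
      · rw [map_mul, map_pow]
        exact hbv.trans_le (le_mul_of_one_le_left zero_le (one_le_pow₀ ha.le))
      · rw [map_mul, map_pow]
        rcases Finset.mem_insert.mp hu with rfl | hu
        · exact (mul_le_of_le_one_left zero_le (pow_le_one₀ zero_le hwa)).trans_lt hbw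
        · exact hN u hu n (Finset.le_sup hu)
    · -- the factor `a ^ m / (1 + a ^ m)` is a unit at `v` and at `w`, and small on `S`
      set m := n + 1 with hm
      have h1 {u : PlaceAboveInfty k K} (hu : 1 < u.val a) :
          u.val (a ^ m / (1 + a ^ m)) = 1 := by
        have h2 : 1 < u.val (a ^ m) := by
          rw [map_pow]
          exact one_lt_pow₀ hu (Nat.succ_ne_zero n)
        rw [map_div₀, Valuation.map_add_eq_of_lt_right _ (by rwa [map_one]),
          div_self (zero_lt_one.trans h2).ne']
      refine ⟨a ^ m / (1 + a ^ m) * b, ?_, fun u hu => ?_⟩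
      · rwa [map_mul, h1 ha, one_mul]
      · rcases Finset.mem_insert.mp hu with rfl | hu
        · rwa [map_mul, h1 hwa, one_mul]
        · have h2 : u.val (a ^ m) < 1 := by
            rw [map_pow]
            exact pow_lt_one₀ zero_le (haS u hu) (Nat.succ_ne_zero n)
          rw [map_mul, map_div₀, Valuation.map_one_add_of_lt _ h2, div_one, map_pow]
          exact hN u hu m ((Finset.le_sup hu).trans (Nat.le_succ n))

theorem exists_sub_one_lt_one (S : Finset (PlaceAboveInfty k K)) {v : PlaceAboveInfty k K}
    (hv : v ∉ S) : ∃ u, v.val (u - 1) < 1 ∧ ∀ w ∈ S, w.val u < 1 := by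
  obtain ⟨a, ha, haS⟩ := exists_one_lt_lt_one S hv
  have h1 : v.val (1 + a) = v.val a := Valuation.map_add_eq_of_lt_right _ (by rwa [map_one])
  refine ⟨a / (1 + a), ?_, fun w hw => ?_⟩
  · have h0 : 1 + a ≠ 0 := by
      rw [← Valuation.ne_zero_iff v.val, h1]
      exact (zero_lt_one.trans ha).ne'
    have e : a / (1 + a) - 1 = -(1 / (1 + a)) := by
      field_simp
      ring
    rw [e, Valuation.map_neg, map_div₀, map_one, h1]
    exact (div_lt_one₀ (zero_lt_one.trans ha)).mpr ha
  · rw [map_div₀, Valuation.map_one_add_of_lt _ (haS w hw), div_one]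
    exact haS w hw

omit [Fintype k] [FunctionField k K] in
theorem val_eq_one_of_sub_one_lt_one {v : PlaceAboveInfty k K} {u : K} (h : v.val (u - 1) < 1) :
    v.val u = 1 := by
  have := Valuation.map_one_add_of_lt _ h
  rwa [add_sub_cancel] at this

/-- There are at most `[K : k(t)]` places above infinity: elements that are close to `1` at one
place and small at the others are linearly independent over `k(t)`. -/
instance finite_placeAboveInfty : Finite (PlaceAboveInfty k K) := by
  classical
  by_contra hinf
  rw [not_finite_iff_infinite] at hinf
  obtain ⟨S, hS⟩ := Infinite.exists_subset_card_eq (PlaceAboveInfty k K)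
    (Module.finrank (RatFunc k) K + 1)
  choose u hu hu' using fun v : S => exists_sub_one_lt_one (S.erase v) (Finset.notMem_erase v.1 S)
  have hli : LinearIndependent (RatFunc k) u := by
    rw [Fintype.linearIndependent_iff]
    intro c hc i
    obtain ⟨j, -, hj⟩ := Finset.exists_max_image Finset.univ
      (fun i => ‖algebraMap (RatFunc k) (LaurentAtInfty k) (c i)‖) ⟨i, Finset.mem_univ i⟩
    by_contra hci
    have hcj : 0 < ‖algebraMap (RatFunc k) (LaurentAtInfty k) (c j)‖ :=
      (norm_pos_iff.mpr ((map_ne_zero _).mpr hci)).trans_le (hj i (Finset.mem_univ i))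
    have hcj0 : c j ≠ 0 := (map_ne_zero _).mp (norm_pos_iff.mp hcj)
    have hsum : ∑ i ∈ Finset.univ.erase j, (c i / c j) • u i = -u j := by
      rw [eq_neg_iff_add_eq_zero, add_comm]
      have := congrArg (fun x => (c j)⁻¹ • x) hc
      simp only [Finset.smul_sum, smul_smul, smul_zero] at this
      rw [← Finset.add_sum_erase _ _ (Finset.mem_univ j), inv_mul_cancel₀ hcj0, one_smul] at this
      simpa only [div_eq_inv_mul] using this
    have hlt : (j.1).val (-u j) < 1 := by
      rw [← hsum]
      refine Valuation.map_sum_lt _ one_ne_zero fun i hi => ?_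
      rw [Algebra.smul_def, map_mul]
      refine (mul_le_of_le_one_left zero_le (val_ratFunc_le_one _ ?_)).trans_lt (hu' i _ ?_)
      · rw [map_div₀, norm_div, div_le_one hcj]
        exact hj i (Finset.mem_univ i)
      · refine Finset.mem_erase.mpr ⟨fun e => ?_, j.2⟩
        exact Finset.ne_of_mem_erase hi (Subtype.ext e.symm)
    rw [Valuation.map_neg, val_eq_one_of_sub_one_lt_one (hu j)] at hlt
    exact lt_irrefl _ hlt
  have := hli.fintype_card_le_finrank
  rw [Fintype.card_coe, hS] at this
  lia

theorem _root_.Valuation.map_pow_sub_one_lt_one {R Γ : Type*} [CommRing R]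
    [LinearOrderedCommGroupWithZero Γ] (ν : Valuation R Γ) {a : R} (h : ν (a - 1) < 1) (n : ℕ) :
    ν (a ^ n - 1) < 1 := by
  have ha : ν a = 1 := by
    have := Valuation.map_one_add_of_lt ν h
    rwa [add_sub_cancel] at this
  induction n with
  | zero => simp
  | succ n ih =>
    rw [show a ^ (n + 1) - 1 = a ^ n * (a - 1) + (a ^ n - 1) by ring]
    refine (Valuation.map_add _ _ _).trans_lt (max_lt ?_ ih)
    rwa [map_mul, map_pow, ha, one_pow, one_mul]

/-- Weak approximation of `ρ` at `v` and of `0` at all other places above infinity. -/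
theorem exists_approx (v : PlaceAboveInfty k K) {ρ : K} (hρ : ρ ≠ 0) :
    ∃ y, v.val (y - ρ) < v.val ρ ∧ ∀ w, w ≠ v → w.val y < 1 := by
  classical
  have := Fintype.ofFinite (PlaceAboveInfty k K)
  obtain ⟨u, hu, hu'⟩ := exists_sub_one_lt_one (Finset.univ.erase v) (Finset.notMem_erase v _)
  have hN (w : PlaceAboveInfty k K) : ∃ N : ℕ, w ≠ v → ∀ n, N ≤ n →
      w.val u ^ n * w.val ρ < 1 := by
    by_cases hw : w = v
    · exact ⟨0, fun h => absurd hw h⟩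
    · obtain ⟨N, hN⟩ := w.exists_pow_mul_val_lt_one
        (hu' w (Finset.mem_erase.mpr ⟨hw, Finset.mem_univ w⟩)) ρ
      exact ⟨N, fun _ => hN⟩
  choose N hN using hN
  refine ⟨u ^ Finset.univ.sup N * ρ, ?_, fun w hw => ?_⟩
  · rw [← sub_one_mul, map_mul]
    exact mul_lt_of_lt_one_left (zero_lt_iff.mpr ((Valuation.ne_zero_iff _).mpr hρ))
      (Valuation.map_pow_sub_one_lt_one _ hu _)
  · rw [map_mul, map_pow]
    exact hN w hw _ (Finset.le_sup (Finset.mem_univ w))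

variable (k) in
/-- The valuation ring of `k(t)` at infinity. -/
def inftyRing : Subring (RatFunc k) where
  carrier := {f | ‖algebraMap (RatFunc k) (LaurentAtInfty k) f‖ ≤ 1}
  zero_mem' := by simp
  one_mem' := by simp
  add_mem' := fun {a b} ha hb => by
    rw [Set.mem_ofPred_eq, map_add]
    exact (IsUltrametricDist.norm_add_le_max _ _).trans (max_le ha hb)
  neg_mem' := fun {a} ha => by simpa using ha
  mul_mem' := fun {a b} ha hb => by
    rw [Set.mem_ofPred_eq, map_mul, norm_mul]
    exact mul_le_one₀ ha (norm_nonneg _) hb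

omit [FunctionField k K] in
/-- An element of `K` that is small at all places above infinity satisfies an equation that shows
its powers to be small in `K_∞`: otherwise some place would contain its inverse. -/
theorem exists_pow_eq_sum {x : K} (hx0 : x ≠ 0) (hx : ∀ v : PlaceAboveInfty k K, v.val x < 1) :
    ∃ (n : ℕ) (c : ℕ → RatFunc k),
      (∀ i, ‖algebraMap (RatFunc k) (LaurentAtInfty k) (c i)‖ ≤ 1) ∧
      (RatFunc.X : RatFunc k) • x ^ n = ∑ i ∈ Finset.range (n + 1), c i • x ^ (n - i) := by
  have hs : (RatFunc.X : RatFunc k)⁻¹ ∈ inftyRing k := by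
    change ‖algebraMap (RatFunc k) (LaurentAtInfty k) _‖ ≤ 1
    rw [map_inv₀, norm_inv, norm_algebraMap_X]
    exact inv_le_one_of_one_le₀ one_lt_card.le
  let A : Subalgebra (inftyRing k) K := Algebra.adjoin (inftyRing k) {x⁻¹}
  let s : A := algebraMap (inftyRing k) A ⟨_, hs⟩
  have hsK : (s : K) = (tElt k K)⁻¹ := map_inv₀ (algebraMap (RatFunc k) K) RatFunc.X
  have htop : Ideal.span {s} = ⊤ := by
    by_contra hne
    obtain ⟨V, hAV, hV⟩ :=
      Ideal.image_subset_nonunits_valuationSubring (A := A.toSubring) (Ideal.span {s}) hne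
    have hsV : (tElt k K)⁻¹ ∈ V.nonunits := by
      rw [← hsK]
      exact hV ⟨s, Ideal.mem_span_singleton_self s, rfl⟩
    have htV : tElt k K ∉ V := by
      rw [ValuationSubring.inv_mem_nonunits_iff] at hsV
      exact hsV.resolve_left ((map_ne_zero _).mpr RatFunc.X_ne_zero)
    have hxV : x⁻¹ ∈ V := hAV (Algebra.subset_adjoin rfl)
    have h1 := hx ⟨V, htV⟩
    rw [← ValuationSubring.valuation_le_one_iff, map_inv₀] at hxV
    have h2 : 0 < V.valuation x := zero_lt_iff.mpr ((Valuation.ne_zero_iff _).mpr hx0)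
    exact absurd h1 (not_lt.mpr ((inv_le_one₀ h2).mp hxV))
  obtain ⟨a, ha⟩ := Ideal.mem_span_singleton.mp (htop ▸ Submodule.mem_top : (1 : A) ∈ _)
  obtain ⟨p, hp⟩ := (Algebra.adjoin_singleton_eq_range_aeval (inftyRing k) x⁻¹).le a.2
  have ha' : algebraMap (RatFunc k) K RatFunc.X = Polynomial.aeval x⁻¹ p := by
    have h1 := congrArg Subtype.val ha
    change (1 : K) = s * a at h1
    rw [hsK, eq_comm, inv_mul_eq_one₀ ((map_ne_zero _).mpr RatFunc.X_ne_zero)] at h1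
    exact h1.trans hp.symm
  refine ⟨p.natDegree, fun i => p.coeff i, fun i => (p.coeff i).2, ?_⟩
  rw [Algebra.smul_def, ha', Polynomial.aeval_eq_sum_range, Finset.sum_mul]
  refine Finset.sum_congr rfl fun i hi => ?_
  rw [Algebra.smul_def, Algebra.smul_def, mul_assoc, inv_pow]
  congr 1
  rw [inv_mul_eq_iff_eq_mul₀ (pow_ne_zero i hx0), ← pow_add,
    Nat.add_sub_cancel' (Nat.lt_succ_iff.mp (Finset.mem_range.mp hi))]

/-- An element of `K` that is small at all places above infinity is topologically nilpotent in
`K_∞`. -/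
theorem tendsto_ofK_pow {x : K} (hx : ∀ v : PlaceAboveInfty k K, v.val x < 1) :
    Tendsto (fun n => ofK k K x ^ n) atTop (𝓝 0) := by
  rcases eq_or_ne x 0 with rfl | hx0
  · rw [map_zero]
    exact tendsto_atTop_of_eventually_const (i₀ := 1) fun n hn =>
      zero_pow (Nat.pos_iff_ne_zero.mp hn)
  obtain ⟨n, c, hc, h⟩ := exists_pow_eq_sum hx0 hx
  set q := (Fintype.card k : ℝ) with hq
  set m : ℕ → ℝ := fun j => ‖ofK k K x ^ j‖ with hm
  have hstep {j : ℕ} {C : ℝ} (hC : 0 ≤ C) (hj : ∀ i ≤ n, m (i + j) ≤ C) : m (n + j) ≤ q⁻¹ * C := by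
    have h1 : (RatFunc.X : RatFunc k) • ofK k K x ^ (n + j) =
        ∑ i ∈ Finset.range (n + 1), c i • ofK k K x ^ (n - i + j) := by
      have h2 := congrArg (fun y => ofK k K (y * x ^ j)) h
      simpa only [smul_mul_assoc, Finset.sum_mul, map_sum, map_smul, map_mul, map_pow, ← pow_add]
        using h2
    rw [le_inv_mul_iff₀ card_pos, hm]
    change _ * ‖_‖ ≤ C
    rw [← norm_X_smul, h1]
    refine IsUltrametricDist.norm_sum_le_of_forall_le_of_nonneg hC fun i _ => ?_
    rw [norm_ratFunc_smul]
    exact (mul_le_of_le_one_left (norm_nonneg _) (hc i)).trans (hj _ (Nat.sub_le n i))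
  set C : ℝ := ∑ i ∈ Finset.range n, m i with hCdef
  have hC : 0 ≤ C := Finset.sum_nonneg fun _ _ => norm_nonneg _
  have hq1 : q⁻¹ < 1 := inv_lt_one_of_one_lt₀ one_lt_card
  have hbase (j : ℕ) : m j ≤ C := by
    induction j using Nat.strong_induction_on with
    | _ j ih =>
      rcases lt_or_ge j n with hj | hj
      · exact Finset.single_le_sum (f := m) (fun _ _ => norm_nonneg _) (Finset.mem_range.mpr hj)
      · obtain ⟨l, rfl⟩ := Nat.exists_eq_add_of_le hj
        by_contra hlt
        rw [not_le] at hlt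
        have h1 : m (n + l) ≤ q⁻¹ * m (n + l) := by
          refine hstep (norm_nonneg _) fun i hi => ?_
          rcases hi.eq_or_lt with rfl | hi
          · exact le_rfl
          · exact (ih _ (by lia)).trans hlt.le
        have h2 : q⁻¹ * m (n + l) < m (n + l) := mul_lt_of_lt_one_left (hC.trans_lt hlt) hq1
        linarith
  have hpow (l : ℕ) : ∀ j, m (n * l + j) ≤ q⁻¹ ^ l * C := by
    induction l with
    | zero => simpa using hbase
    | succ l ih =>
      intro j
      have h1 := hstep (j := n * l + j) (C := q⁻¹ ^ l * C) (by positivity) fun i _ => by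
        rw [show i + (n * l + j) = n * l + (i + j) by ring]
        exact ih _
      rw [show n * (l + 1) + j = n + (n * l + j) by ring, pow_succ', mul_assoc]
      exact h1
  rw [tendsto_zero_iff_norm_tendsto_zero, Metric.tendsto_atTop]
  intro ε hε
  have hlim : Tendsto (fun l : ℕ => q⁻¹ ^ l * C) atTop (𝓝 0) := by
    simpa using (tendsto_pow_atTop_nhds_zero_of_lt_one (by positivity) hq1).mul_const C
  obtain ⟨l, hl⟩ := (hlim.eventually_lt_const hε).exists
  refine ⟨n * l, fun j hj => ?_⟩
  obtain ⟨i, rfl⟩ := Nat.exists_eq_add_of_le hj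
  rw [Real.dist_eq, sub_zero, abs_of_nonneg (norm_nonneg _)]
  exact (hpow l i).trans_lt hl

end PlaceAboveInfty
end Places

/-! ### Roots of `t X + X ^ q = δ` -/

section Root

open Filter Topology

theorem _root_.Valued.nonarchimedeanRing (R Γ : Type*) [Ring R] [LinearOrderedCommGroupWithZero Γ]
    [Valued R Γ] : NonarchimedeanRing R :=
  (Valued.toUniformSpace_eq R Γ).symm ▸
    (Valued.v (R := R) (Γ₀ := Γ)).subgroups_basis.nonarchimedean

theorem _root_.Valued.tendsto_zero_of_forall_eventually_lt {F Γ : Type*} [Field F]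
    [LinearOrderedCommGroupWithZero Γ] [Valued F Γ] {f : ℕ → F}
    (h : ∀ y : F, y ≠ 0 → ∀ᶠ n in atTop, Valued.v (f n) < Valued.v y) : Tendsto f atTop (𝓝 0) := by
  rw [(Valued.hasBasis_nhds_zero F Γ).tendsto_right_iff]
  intro γ _
  obtain ⟨y, hy⟩ := MonoidWithZeroHom.ValueGroup₀.restrict₀_surjective
    (.ofClass (Valued.v (R := F) (Γ₀ := Γ))) γ.1
  have hy0 : y ≠ 0 := by
    rintro rfl
    exact γ.ne_zero (by rw [← hy, map_zero])
  filter_upwards [h y hy0] with n hn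
  rw [← hy]
  exact Valuation.restrict_lt_iff _ |>.mpr hn

variable {k : Type*} [Field k] [Fintype k] {K : Type*} [Field K] [Algebra (RatFunc k) K]

variable (k) in
/-- The ratio `-δ ^ (q - 1) / t ^ q`, which controls the convergence of `approxRoot k δ`. -/
def rootRatio (δ : K) : K :=
  -δ ^ (Fintype.card k - 1) / algebraMap (RatFunc k) K RatFunc.X ^ Fintype.card k

variable (k) in
/-- The partial sums of the series that solves `t z + z ^ q = δ` by iterating
`z ↦ (δ - z ^ q) / t`, starting at `0`. -/
def approxRoot (δ : K) (n : ℕ) : K :=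
  ∑ i ∈ Finset.range n, δ * rootRatio k δ ^ repunit (Fintype.card k) i /
    algebraMap (RatFunc k) K RatFunc.X

theorem approxRoot_succ (δ : K) (n : ℕ) :
    algebraMap (RatFunc k) K RatFunc.X * approxRoot k δ (n + 1) +
      approxRoot k δ n ^ Fintype.card k = δ := by
  have ht : algebraMap (RatFunc k) K RatFunc.X ≠ 0 := (map_ne_zero _).mpr RatFunc.X_ne_zero
  induction n with
  | zero =>
    simp [approxRoot, repunit, zero_pow (Fintype.card_ne_zero (α := k)), mul_div_cancel₀ _ ht]
  | succ n ih =>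
    have h1 : approxRoot k δ (n + 1) ^ Fintype.card k = approxRoot k δ n ^ Fintype.card k +
        (δ * rootRatio k δ ^ repunit (Fintype.card k) n /
          algebraMap (RatFunc k) K RatFunc.X) ^ Fintype.card k := by
      have := add_pow_card_pow (k := k) (approxRoot k δ n)
        (δ * rootRatio k δ ^ repunit (Fintype.card k) n / algebraMap (RatFunc k) K RatFunc.X) 1
      rw [pow_one] at this
      rw [← this, approxRoot, approxRoot, Finset.sum_range_succ]
    have h2 : algebraMap (RatFunc k) K RatFunc.X *
        (δ * rootRatio k δ ^ repunit (Fintype.card k) (n + 1) /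
          algebraMap (RatFunc k) K RatFunc.X) +
        (δ * rootRatio k δ ^ repunit (Fintype.card k) n /
          algebraMap (RatFunc k) K RatFunc.X) ^ Fintype.card k = 0 := by
      rw [mul_div_cancel₀ _ ht, repunit, pow_succ, pow_mul']
      conv_lhs => enter [1, 2, 2]; rw [rootRatio]
      have h3 : δ ^ Fintype.card k = δ * δ ^ (Fintype.card k - 1) :=
        (mul_pow_sub_one Fintype.card_ne_zero δ).symm
      rw [div_pow, mul_pow, h3]
      field_simp
      ring
    rw [h1, show approxRoot k δ (n + 1 + 1) = approxRoot k δ (n + 1) + _ from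
      Finset.sum_range_succ _ _]
    linear_combination ih + h2

/-- If the ratio is topologically nilpotent, then the series for a root converges. -/
theorem exists_tendsto_approxRoot {B : Type*} [CommRing B] [UniformSpace B] [IsUniformAddGroup B]
    [IsTopologicalRing B] [CompleteSpace B] [T2Space B] [NonarchimedeanAddGroup B] (φ : K →+* B)
    {δ : K} (h : Tendsto (fun n => φ (rootRatio k δ) ^ n) atTop (𝓝 0)) :
    ∃ z, Tendsto (fun n => φ (approxRoot k δ n)) atTop (𝓝 z) ∧
      φ (algebraMap (RatFunc k) K RatFunc.X) * z + z ^ Fintype.card k = φ δ := by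
  have hc : CauchySeq fun n => φ (approxRoot k δ n) := by
    refine NonarchimedeanAddGroup.cauchySeq_of_tendsto_sub_nhds_zero ?_
    have e (n : ℕ) : φ (approxRoot k δ (n + 1)) - φ (approxRoot k δ n) =
        φ (δ / algebraMap (RatFunc k) K RatFunc.X) *
          φ (rootRatio k δ) ^ repunit (Fintype.card k) n := by
      rw [← map_sub, ← map_pow, ← map_mul, approxRoot, approxRoot, Finset.sum_range_succ,
        add_sub_cancel_left, div_mul_eq_mul_div]
    simp only [e]
    rw [← mul_zero (φ (δ / algebraMap (RatFunc k) K RatFunc.X))]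
    exact (h.comp (tendsto_atTop_mono (le_repunit Fintype.one_lt_card) tendsto_id)).const_mul _
  obtain ⟨z, hz⟩ := cauchySeq_tendsto_of_complete hc
  refine ⟨z, hz, ?_⟩
  have h1 := ((hz.comp (tendsto_add_atTop_nat 1)).const_mul
    (φ (algebraMap (RatFunc k) K RatFunc.X))).add (hz.pow (Fintype.card k))
  refine tendsto_nhds_unique h1 ?_
  simp only [Function.comp_apply, ← map_mul, ← map_pow, ← map_add, approxRoot_succ]
  exact tendsto_const_nhds

namespace PlaceAboveInfty

variable {v : PlaceAboveInfty k K}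

theorem val_approxRoot_le {δ : K} (h : v.val (rootRatio k δ) ≤ 1) (n : ℕ) :
    v.val (approxRoot k δ n) ≤ v.val δ / v.val (tElt k K) := by
  refine Valuation.map_sum_le _ fun i _ => ?_
  rw [map_div₀, map_mul, map_pow]
  exact div_le_div_of_nonneg_right (mul_le_of_le_one_right zero_le (pow_le_one₀ zero_le h)) zero_le

theorem val_rootRatio_lt_one {δ : K}
    (h : v.val δ ^ (Fintype.card k - 1) < v.val (tElt k K) ^ Fintype.card k) :
    v.val (rootRatio k δ) < 1 := by
  rw [rootRatio, map_div₀, Valuation.map_neg, map_pow, map_pow]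
  exact (div_lt_one₀ (zero_le.trans_lt h)).mpr h

/-- If `x ^ (q - 1)` is a first approximation of `-t`, then `δ = t x + x ^ q` is so small that the
equation `t X + X ^ q = δ` has a small root. -/
theorem val_pow_lt_of_val_add_lt {x : K}
    (h : v.val (x ^ (Fintype.card k - 1) + tElt k K) < v.val (tElt k K)) :
    v.val x ^ (Fintype.card k - 1) = v.val (tElt k K) ∧
      v.val (tElt k K * x + x ^ Fintype.card k) < v.val x * v.val (tElt k K) ∧
      v.val (tElt k K * x + x ^ Fintype.card k) ^ (Fintype.card k - 1) <
        v.val (tElt k K) ^ Fintype.card k := by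
  have hn : Fintype.card k - 1 ≠ 0 := (Nat.sub_pos_of_lt Fintype.one_lt_card).ne'
  have h1 : v.val x ^ (Fintype.card k - 1) = v.val (tElt k K) := by
    rw [← map_pow, ← Valuation.map_neg _ (tElt k K)]
    refine Valuation.map_eq_of_sub_lt _ ?_
    rwa [sub_neg_eq_add, Valuation.map_neg]
  have hx : 0 < v.val x := by
    rw [zero_lt_iff]
    intro e
    rw [e, zero_pow hn] at h1
    exact (zero_lt_one.trans v.one_lt_val_t).ne h1
  have h2 : v.val (tElt k K * x + x ^ Fintype.card k) < v.val x * v.val (tElt k K) := by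
    rw [← mul_pow_sub_one Fintype.card_ne_zero x, mul_comm (tElt k K), ← mul_add, map_mul, add_comm]
    exact mul_lt_mul_of_pos_left h hx
  refine ⟨h1, h2, (pow_lt_pow_left₀ h2 zero_le hn).trans_eq ?_⟩
  rw [mul_pow, h1, mul_pow_sub_one Fintype.card_ne_zero]

variable (v) in
/-- The embedding of `K` into its completion. -/
def toCompletion : K →+* v.Completion :=
  UniformSpace.Completion.coeRingHom.comp
    (WithVal.equiv v.1.valuation).symm.toRingHom

omit [Fintype k] in
theorem v_toCompletion (x : K) : Valued.v (v.toCompletion x) = v.val x :=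
  Valued.valuedCompletion_apply _

variable [FunctionField k K]

theorem tendsto_toCompletion_pow {x : K} (hx : v.val x < 1) :
    Tendsto (fun n => v.toCompletion x ^ n) atTop (𝓝 0) := by
  have h : Tendsto (fun n => ((WithVal.equiv v.1.valuation).symm x) ^ n) atTop (𝓝 0) := by
    refine Valued.tendsto_zero_of_forall_eventually_lt fun y hy => ?_
    obtain ⟨N, hN⟩ := v.exists_pow_mul_val_lt_one hx (WithVal.equiv v.1.valuation y)⁻¹
    filter_upwards [eventually_ge_atTop N] with n hn
    have h1 := hN n hn
    have hy0 : v.val (WithVal.equiv v.1.valuation y) ≠ 0 :=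
      (Valuation.ne_zero_iff _).mpr ((map_ne_zero_iff _ (RingEquiv.injective _)).mpr hy)
    rw [map_inv₀, mul_inv_lt_iff₀ (zero_lt_iff.mpr hy0), one_mul] at h1
    rw [map_pow]
    exact h1
  have h2 := (UniformSpace.Completion.continuous_coe (WithVal v.1.valuation)).tendsto 0 |>.comp h
  rw [UniformSpace.Completion.coe_zero] at h2
  refine h2.congr fun n => ?_
  exact map_pow UniformSpace.Completion.coeRingHom _ n

/-- The place `v` has a root of `-t` if `K` contains a first approximation of one: this is Hensel's
lemma, in the form of the convergence of `approxRoot`. -/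
theorem hasRoot_iff : v.HasRoot ↔
    ∃ x, v.val (x ^ (Fintype.card k - 1) + tElt k K) < v.val (tElt k K) := by
  have hn : Fintype.card k - 1 ≠ 0 := (Nat.sub_pos_of_lt Fintype.one_lt_card).ne'
  have ht0 : v.toCompletion (tElt k K) ≠ 0 :=
    (map_ne_zero _).mpr ((map_ne_zero _).mpr RatFunc.X_ne_zero)
  constructor
  · rintro ⟨ρ, hρ⟩
    replace hρ : ρ ^ (Fintype.card k - 1) = -v.toCompletion (tElt k K) := hρ
    have hρ0 : ρ ≠ 0 := by
      rintro rfl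
      rw [zero_pow hn, zero_eq_neg] at hρ
      exact ht0 hρ
    have hvρ : Valued.v ρ ≠ 0 := (Valuation.ne_zero_iff _).mpr hρ0
    have hnhds : {y | Valued.v (y - ρ) < Valued.v ρ} ∈ 𝓝 ρ := by
      rw [Valued.mem_nhds]
      refine ⟨Units.mk0 (Valued.v.restrict ρ) ?_, fun y hy => ?_⟩
      · rwa [Ne, Valuation.restrict_eq_zero_iff]
      · exact (Valuation.restrict_lt_iff _).mp hy
    obtain ⟨x, hx⟩ := UniformSpace.Completion.denseRange_coe.exists_mem_open isOpen_interior
      ⟨ρ, mem_interior_iff_mem_nhds.mpr hnhds⟩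
    set y := WithVal.equiv v.1.valuation x
    have hy : v.toCompletion y ∈ {y | Valued.v (y - ρ) < Valued.v ρ} := interior_subset hx
    rw [Set.mem_ofPred_eq] at hy
    refine ⟨y, ?_⟩
    have h1 : Valued.v (v.toCompletion y / ρ - 1) < 1 := by
      rwa [div_sub_one hρ0, map_div₀, div_lt_one₀ (zero_lt_iff.mpr hvρ)]
    have h2 := Valuation.map_pow_sub_one_lt_one _ h1 (Fintype.card k - 1)
    rw [div_pow, hρ, div_sub_one (neg_ne_zero.mpr ht0), map_div₀, Valuation.map_neg,
      sub_neg_eq_add, ← map_pow, ← map_add, v_toCompletion, v_toCompletion,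
      div_lt_one₀ (zero_lt_one.trans v.one_lt_val_t)] at h2
    exact h2
  · rintro ⟨x, hx⟩
    obtain ⟨h1, h2, h3⟩ := val_pow_lt_of_val_add_lt hx
    have := Valued.nonarchimedeanRing v.Completion v.1.ValueGroup
    obtain ⟨z, hz, hz'⟩ := exists_tendsto_approxRoot v.toCompletion
      (tendsto_toCompletion_pow (val_rootRatio_lt_one h3))
    have hzx : v.toCompletion x - z ≠ 0 := by
      intro e
      rw [sub_eq_zero] at e
      have hx0 : Valued.v z ≠ 0 := by
        rw [← e, v_toCompletion]
        intro e'
        rw [e', zero_mul] at h2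
        exact not_lt_zero h2
      obtain ⟨n, hn'⟩ := (hz.eventually (Valued.locally_const hx0)).exists
      replace hn' : Valued.v (v.toCompletion _) = Valued.v z := hn'
      rw [← e, v_toCompletion, v_toCompletion] at hn'
      have h4 := val_approxRoot_le (val_rootRatio_lt_one h3).le n
      rw [hn', le_div_iff₀ (zero_lt_one.trans v.one_lt_val_t)] at h4
      exact h4.not_gt h2
    refine ⟨v.toCompletion x - z, ?_⟩
    change _ = -v.toCompletion (tElt k K)
    let := (v.toCompletion.comp (algebraMap (RatFunc k) K)).toAlgebra
    have h5 := add_pow_card_pow (k := k) (v.toCompletion x - z) z 1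
    rw [sub_add_cancel, pow_one] at h5
    rw [map_add, map_mul, map_pow] at hz'
    refine mul_left_cancel₀ hzx ?_
    rw [mul_pow_sub_one Fintype.card_ne_zero]
    linear_combination -hz' - h5

end PlaceAboveInfty
end Root

/-! ### The `t`-torsion and the places where `-t` has a root -/

section TorsionPlaces

open KInfty PlaceAboveInfty Filter Topology

variable {k : Type*} [Field k] [Fintype k] {K : Type*} [Field K] [Algebra (RatFunc k) K]

theorem mul_repunit_add_one {q : ℕ} (hq : 0 < q) (i : ℕ) : (q - 1) * repunit q i + 1 = q ^ i := by
  obtain ⟨n, rfl⟩ := Nat.exists_eq_add_of_lt hq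
  induction i with
  | zero => simp [repunit]
  | succ i ih =>
    rw [repunit, pow_succ', ← ih]
    simp only [zero_add, Nat.add_sub_cancel]
    ring

theorem prod_sub_const {B : Type*} [CommRing B] [Algebra k B] (x : B) :
    ∏ c : k, (x - algebraMap k B c) = x ^ Fintype.card k - x := by
  have hroots := FiniteField.roots_X_pow_card_sub_X k
  have hdeg := FiniteField.X_pow_card_sub_X_natDegree_eq k (Fintype.one_lt_card (α := k))
  have h := Polynomial.prod_multiset_X_sub_C_of_monic_of_roots_card_eq
    (p := (Polynomial.X ^ Fintype.card k - Polynomial.X : k[X]))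
    (Polynomial.monic_X_pow_sub (by rw [Polynomial.degree_X]; exact_mod_cast Fintype.one_lt_card))
    (by rw [hroots, hdeg]; rfl)
  rw [hroots] at h
  have h' := congrArg (Polynomial.aeval x) h
  rw [map_multiset_prod, Multiset.map_map] at h'
  simpa using h'

namespace PlaceAboveInfty

/-- The elements `x` of `K` with `v (x ^ (q - 1)) < v t`. Approximations in `K` of a `t`-torsion
point are either in this subgroup, or have the size of the nonzero `t`-torsion points of `K_v`. -/
def smallAt (v : PlaceAboveInfty k K) : AddSubgroup K where
  carrier := {x | v.val x ^ (Fintype.card k - 1) < v.val (tElt k K)}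
  zero_mem' := by
    rw [Set.mem_ofPred_eq, map_zero, zero_pow (Nat.sub_pos_of_lt Fintype.one_lt_card).ne']
    exact zero_lt_one.trans v.one_lt_val_t
  add_mem' {x y} hx hy := by
    refine (pow_le_pow_left₀ zero_le (Valuation.map_add v.val x y) _).trans_lt ?_
    rcases max_choice (v.val x) (v.val y) with h | h <;> rw [h]
    exacts [hx, hy]
  neg_mem' {x} hx := by
    rwa [Set.mem_ofPred_eq, Valuation.map_neg]

variable {v : PlaceAboveInfty k K}

theorem mem_smallAt {x : K} :
    x ∈ v.smallAt ↔ v.val x ^ (Fintype.card k - 1) < v.val (tElt k K) := Iff.rfl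

theorem mem_smallAt_of_le {x y : K} (hy : y ∈ v.smallAt) (h : v.val x ≤ v.val y) :
    x ∈ v.smallAt :=
  (pow_le_pow_left₀ zero_le h _).trans_lt hy

theorem mem_smallAt_of_le_one {x : K} (h : v.val x ≤ 1) : x ∈ v.smallAt :=
  (pow_le_one₀ zero_le h).trans_lt v.one_lt_val_t

theorem mem_smallAt_of_lt {x y : K} (hy : v.val y ^ (Fintype.card k - 1) = v.val (tElt k K))
    (h : v.val x < v.val y) : x ∈ v.smallAt :=
  (pow_lt_pow_left₀ h zero_le (Nat.sub_pos_of_lt Fintype.one_lt_card).ne').trans_eq hy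

theorem const_smul_mem_smallAt {x : K} (c : k) (h : x ∈ v.smallAt) :
    algebraMap k (RatFunc k) c • x ∈ v.smallAt := by
  rcases eq_or_ne c 0 with rfl | hc
  · simp
  · refine mem_smallAt_of_le h ?_
    rw [Algebra.smul_def, map_mul, v.val_const hc, one_mul]

theorem val_const_smul {c : k} (hc : c ≠ 0) (x : K) :
    v.val (algebraMap k (RatFunc k) c • x) = v.val x := by
  rw [Algebra.smul_def, map_mul, v.val_const hc, one_mul]

theorem val_pow_add_lt_of_notMem_smallAt {x : K}
    (h : v.val (tElt k K * x + x ^ Fintype.card k) < v.val (tElt k K)) (hx : x ∉ v.smallAt) :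
    v.val (x ^ (Fintype.card k - 1) + tElt k K) < v.val (tElt k K) := by
  have h1 : 1 ≤ v.val x := by
    by_contra h1
    exact hx (mem_smallAt_of_le_one (not_le.mp h1).le)
  refine lt_of_le_of_lt ?_ h
  rw [← mul_pow_sub_one Fintype.card_ne_zero x, mul_comm (tElt k K), ← mul_add, map_mul, add_comm]
  exact le_mul_of_one_le_left zero_le h1

/-- Two first approximations of `(q - 1)`-st roots of `-t` differ by a factor in `k`, up to a small
element. -/
theorem exists_sub_smul_mem_smallAt {x ρ : K}
    (hρ : v.val (ρ ^ (Fintype.card k - 1) + tElt k K) < v.val (tElt k K))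
    (h : v.val (tElt k K * x + x ^ Fintype.card k) < v.val (tElt k K)) :
    ∃ c : k, x - algebraMap k (RatFunc k) c • ρ ∈ v.smallAt := by
  by_cases hx : x ∈ v.smallAt
  · exact ⟨0, by simpa using hx⟩
  have hx' := val_pow_add_lt_of_notMem_smallAt h hx
  have h1 := (val_pow_lt_of_val_add_lt hρ).1
  have hρ0 : ρ ≠ 0 := by
    rintro rfl
    rw [map_zero, zero_pow (Nat.sub_pos_of_lt Fintype.one_lt_card).ne'] at h1
    exact (zero_lt_one.trans v.one_lt_val_t).ne h1
  have hvρ : v.val ρ ≠ 0 := (Valuation.ne_zero_iff _).mpr hρ0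
  have hxρ : v.val x = v.val ρ := by
    rw [← pow_left_inj₀ zero_le zero_le (Nat.sub_pos_of_lt (Fintype.one_lt_card (α := k))).ne', h1,
      (val_pow_lt_of_val_add_lt hx').1]
  have h2 : v.val ((x / ρ) ^ (Fintype.card k - 1) - 1) < 1 := by
    rw [div_pow, div_sub_one (pow_ne_zero _ hρ0), map_div₀, map_pow, h1,
      div_lt_one₀ (zero_lt_one.trans v.one_lt_val_t)]
    have := Valuation.map_sub_lt _ hx' hρ
    rwa [add_sub_add_right_eq_sub] at this
  let := ((algebraMap (RatFunc k) K).comp (algebraMap k (RatFunc k))).toAlgebra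
  have h3 : v.val (∏ c : k, (x / ρ - algebraMap k K c)) < 1 := by
    rw [prod_sub_const, ← mul_pow_sub_one Fintype.card_ne_zero (x / ρ), ← mul_sub_one, map_mul,
      map_div₀, hxρ, div_self hvρ, one_mul]
    exact h2
  rw [map_prod] at h3
  obtain ⟨c, hc⟩ : ∃ c : k, v.val (x / ρ - algebraMap k K c) < 1 := by
    by_contra! hcon
    exact h3.not_ge (Finset.one_le_prod fun c _ => hcon c)
  refine ⟨c, mem_smallAt_of_lt h1 ?_⟩
  have e : x - algebraMap k (RatFunc k) c • ρ = (x / ρ - algebraMap k K c) * ρ := by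
    rw [sub_mul, div_mul_cancel₀ _ hρ0, Algebra.smul_def]
    rfl
  rw [e, map_mul]
  exact mul_lt_of_lt_one_left (zero_lt_iff.mpr hvρ) hc

variable [FunctionField k K]

/-- Approximations of `t`-torsion points of `K_∞` are approximate `t`-torsion points at each
place. -/
theorem val_lt_of_mem_torsion {τ : KInfty k K} (hτ : τ ∈ torsion k K) {x : K}
    (hx : ‖ofK k K x - τ‖ < 1) (v : PlaceAboveInfty k K) :
    v.val (tElt k K * x + x ^ Fintype.card k) < v.val (tElt k K) := by
  have ht : 0 < v.val (tElt k K) := zero_lt_one.trans v.one_lt_val_t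
  set e := ofK k K x - τ with he
  have h : (RatFunc.X : RatFunc k) • ofK k K ((tElt k K * x + x ^ Fintype.card k) / tElt k K) =
      (RatFunc.X : RatFunc k) • e + e ^ Fintype.card k := by
    have h1 := add_pow_card_pow (k := k) e τ 1
    rw [pow_one, he, sub_add_cancel, ← he] at h1
    rw [← map_smul, Algebra.smul_def, mul_div_cancel₀ _ ((map_ne_zero _).mpr RatFunc.X_ne_zero),
      map_add, ← Algebra.smul_def, map_smul, map_pow, h1, he, smul_sub]
    linear_combination mem_torsion.mp hτ
  have h2 : ‖ofK k K ((tElt k K * x + x ^ Fintype.card k) / tElt k K)‖ < 1 := by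
    rw [← mul_lt_mul_iff_right₀ (card_pos (k := k)), ← norm_X_smul, h, mul_one]
    refine (IsUltrametricDist.norm_add_le_max _ _).trans_lt (max_lt ?_ ?_)
    · rw [norm_X_smul]
      exact mul_lt_of_lt_one_right card_pos hx
    · exact (norm_pow_le' e Fintype.card_pos).trans_lt
        ((pow_lt_one₀ (norm_nonneg e) hx Fintype.card_ne_zero).trans one_lt_card)
  have h3 := val_lt_one_of_norm_lt_one (v := v) h2
  rwa [map_div₀, div_lt_one₀ ht] at h3

/-- A `t`-torsion point with an approximation that is small at all places vanishes: its powers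
`τ ^ (q ^ i)` are the multiples of `τ` by `(-t) ^ ((q ^ i - 1) / (q - 1))`, but grow more slowly
than these factors. -/
theorem eq_zero_of_mem_torsion {τ : KInfty k K} (hτ : τ ∈ torsion k K) {x : K}
    (hx : ‖τ - ofK k K x‖ < 1) (h : ∀ v : PlaceAboveInfty k K, x ∈ v.smallAt) : τ = 0 := by
  set q := Fintype.card k with hq
  set e := τ - ofK k K x with he
  set s : ℕ → RatFunc k := fun i => ((-RatFunc.X : RatFunc k) ^ repunit q i)⁻¹ with hs
  have hs0 (i) : (-RatFunc.X : RatFunc k) ^ repunit q i ≠ 0 :=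
    pow_ne_zero _ (neg_ne_zero.mpr RatFunc.X_ne_zero)
  have h1 (i : ℕ) : τ = ofK k K x * ofK k K (x ^ (q - 1) / -tElt k K) ^ repunit q i +
      s i • e ^ q ^ i := by
    have h2 := pow_card_pow_eq (pow_card_eq_of_mem_torsion hτ) i
    have h3 := add_pow_card_pow (k := k) (ofK k K x) e i
    rw [he, add_sub_cancel, ← he, ← hq, h2] at h3
    rw [← inv_smul_smul₀ (hs0 i) τ, h3, smul_add]
    congr 1
    rw [← map_pow, ← map_pow, ← map_mul, ← map_smul, Algebra.smul_def, div_pow, map_inv₀, map_pow,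
      map_neg, inv_mul_eq_div, ← mul_div_assoc, ← pow_mul, mul_comm x, ← pow_succ,
      mul_repunit_add_one Fintype.card_pos]
  have h2 : Tendsto (fun i => ofK k K x * ofK k K (x ^ (q - 1) / -tElt k K) ^ repunit q i) atTop
      (𝓝 0) := by
    rw [← mul_zero (ofK k K x)]
    refine ((tendsto_ofK_pow fun v => ?_).comp
      (tendsto_atTop_mono (le_repunit Fintype.one_lt_card) tendsto_id)).const_mul _
    rw [map_div₀, Valuation.map_neg, map_pow, div_lt_one₀ (zero_lt_one.trans v.one_lt_val_t)]
    exact h v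
  have h3 : Tendsto (fun i => s i • e ^ q ^ i) atTop (𝓝 0) := by
    have h4 : Tendsto (fun i => ‖e‖ ^ q ^ i) atTop (𝓝 0) :=
      (tendsto_pow_atTop_nhds_zero_of_lt_one (norm_nonneg e) hx).comp
        (tendsto_pow_atTop_atTop_of_one_lt Fintype.one_lt_card)
    refine squeeze_zero_norm (fun i => ?_) h4
    rw [norm_ratFunc_smul]
    refine (mul_le_of_le_one_left (norm_nonneg _) ?_).trans
      (norm_pow_le' e (pow_pos Fintype.card_pos i))
    rw [hs, map_inv₀, norm_inv, map_pow, norm_pow, map_neg, norm_neg, norm_algebraMap_X]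
    exact inv_le_one_of_one_le₀ (one_le_pow₀ one_lt_card.le)
  have h5 := h2.add h3
  simp only [← h1, add_zero] at h5
  exact tendsto_nhds_unique tendsto_const_nhds h5

/-- A first approximation of a root at a single place lifts to a `t`-torsion point of `K_∞`, which
is small at the other places. -/
theorem exists_mem_torsion {ρ : K}
    (hρ : v.val (ρ ^ (Fintype.card k - 1) + tElt k K) < v.val (tElt k K)) :
    ∃ τ ∈ torsion k K, ∃ x, ‖τ - ofK k K x‖ < 1 ∧ x - ρ ∈ v.smallAt ∧
      ∀ w, w ≠ v → x ∈ w.smallAt := by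
  have hn : Fintype.card k - 1 ≠ 0 := (Nat.sub_pos_of_lt Fintype.one_lt_card).ne'
  have h1 := (val_pow_lt_of_val_add_lt hρ).1
  have hρ0 : ρ ≠ 0 := by
    rintro rfl
    rw [map_zero, zero_pow hn] at h1
    exact (zero_lt_one.trans v.one_lt_val_t).ne h1
  obtain ⟨y, hy, hy'⟩ := v.exists_approx hρ0
  have hyv : v.val (y ^ (Fintype.card k - 1) + tElt k K) < v.val (tElt k K) := by
    have h2 : v.val (y / ρ - 1) < 1 := by
      rwa [div_sub_one hρ0, map_div₀,
        div_lt_one₀ (zero_lt_iff.mpr ((Valuation.ne_zero_iff _).mpr hρ0))]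
    have h3 := Valuation.map_pow_sub_one_lt_one _ h2 (Fintype.card k - 1)
    rw [div_pow, div_sub_one (pow_ne_zero _ hρ0), map_div₀, map_pow _ ρ, h1,
      div_lt_one₀ (zero_lt_one.trans v.one_lt_val_t)] at h3
    have := Valuation.map_add_lt _ h3 hρ
    rwa [← add_assoc, sub_add_cancel] at this
  set δ := tElt k K * y + y ^ Fintype.card k with hδ
  -- at every place the correction `approxRoot k δ n` converges and is small
  have hδw (w : PlaceAboveInfty k K) : w.val (rootRatio k δ) < 1 ∧
      ∀ x, w.val x ≤ w.val δ / w.val (tElt k K) → x ∈ w.smallAt := by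
    have ht := w.one_lt_val_t
    by_cases hw : w = v
    · subst hw
      obtain ⟨h2, h3, h4⟩ := val_pow_lt_of_val_add_lt hyv
      refine ⟨val_rootRatio_lt_one h4, fun x hx => mem_smallAt_of_lt h2 (hx.trans_lt ?_)⟩
      exact (div_lt_iff₀ (zero_lt_one.trans ht)).mpr h3
    · have h2 : w.val δ < w.val (tElt k K) := by
        refine Valuation.map_add_lt _ ?_ ?_
        · rw [map_mul]
          exact mul_lt_of_lt_one_right (zero_lt_one.trans ht) (hy' w hw)
        · rw [map_pow]
          exact (pow_lt_one₀ zero_le (hy' w hw) Fintype.card_ne_zero).trans ht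
      refine ⟨val_rootRatio_lt_one ?_, fun x hx => mem_smallAt_of_le_one (hx.trans ?_)⟩
      · exact (pow_lt_pow_left₀ h2 zero_le hn).trans_le
          (pow_le_pow_right₀ ht.le (Nat.sub_le _ _))
      · exact ((div_lt_one₀ (zero_lt_one.trans ht)).mpr h2).le
  obtain ⟨z, hz, hz'⟩ := exists_tendsto_approxRoot (ofK k K).toRingHom
    (tendsto_ofK_pow fun w => (hδw w).1)
  obtain ⟨n, hn'⟩ := (Metric.tendsto_atTop.mp hz 1 one_pos).imp fun n h => h n le_rfl
  have hsm (w : PlaceAboveInfty k K) : approxRoot k δ n ∈ w.smallAt :=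
    (hδw w).2 _ (val_approxRoot_le (hδw w).1.le n)
  refine ⟨ofK k K y - z, ?_, y - approxRoot k δ n, ?_, ?_, fun w hw => ?_⟩
  · rw [mem_torsion]
    have h5 := add_pow_card_pow (k := k) (ofK k K y - z) z 1
    rw [sub_add_cancel, pow_one] at h5
    replace hz' : ofK k K (tElt k K) * z + z ^ Fintype.card k = ofK k K δ := hz'
    rw [hδ, map_add, map_mul, map_pow] at hz'
    have h6 : (RatFunc.X : RatFunc k) • (ofK k K y - z) = ofK k K (tElt k K) * (ofK k K y - z) := by
      rw [Algebra.smul_def, (ofK k K).commutes]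
    rw [h6]
    linear_combination -hz' - h5
  · rw [map_sub, sub_sub_sub_cancel_left, ← dist_eq_norm]
    exact hn'
  · rw [sub_right_comm]
    exact sub_mem (mem_smallAt_of_lt h1 hy) (hsm v)
  · exact sub_mem (mem_smallAt_of_le_one (hy' w hw).le) (hsm w)

end PlaceAboveInfty

variable [FunctionField k K]

variable (k K) in
/-- Lifts of approximate roots, one for each place where `-t` has a root, form a basis of the
`t`-torsion. -/
theorem rank_torsion_eq_card_hasRoot :
    Module.rank k (torsion k K) = (Nat.card {v : PlaceAboveInfty k K // v.HasRoot} : Cardinal) := by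
  classical
  let S := {v : PlaceAboveInfty k K // v.HasRoot}
  have := Fintype.ofFinite S
  choose ρ hρ using fun v : S => hasRoot_iff.mp v.2
  choose τ hτ x hx hxρ hx' using fun v : S => exists_mem_torsion (hρ v)
  -- the approximation of a linear combination of the `τ w` is governed at `v` by `c v`
  have hcomb (c : S → k) (v : S) : ∑ w, algebraMap k (RatFunc k) (c w) • x w -
      algebraMap k (RatFunc k) (c v) • ρ v ∈ v.1.smallAt := by
    rw [← Finset.add_sum_erase _ _ (Finset.mem_univ v), add_sub_right_comm, ← smul_sub]
    refine add_mem (const_smul_mem_smallAt _ (hxρ v)) (sum_mem fun w hw => ?_)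
    exact const_smul_mem_smallAt _
      (hx' w v.1 fun e => Finset.ne_of_mem_erase hw (Subtype.ext e.symm))
  have hnorm (c : S → k) : ‖∑ w, c w • τ w -
      ofK k K (∑ w, algebraMap k (RatFunc k) (c w) • x w)‖ < 1 := by
    have e : ∑ w, c w • τ w - ofK k K (∑ w, algebraMap k (RatFunc k) (c w) • x w) =
        ∑ w, algebraMap k (RatFunc k) (c w) • (τ w - ofK k K (x w)) := by
      simp only [map_sum, map_smul, smul_sub, Finset.sum_sub_distrib, algebraMap_smul]
    rw [e]
    refine Finset.sum_induction _ (fun y => ‖y‖ < 1)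
      (fun y z hy hz => (IsUltrametricDist.norm_add_le_max y z).trans_lt (max_lt hy hz))
      (by simp) fun w _ => ?_
    rw [norm_ratFunc_smul]
    refine (mul_le_of_le_one_left (norm_nonneg _) ?_).trans_lt (hx w)
    rcases eq_or_ne (c w) 0 with h | h
    · simp [h]
    · exact (norm_algebraMap_const h).le
  let b : S → torsion k K := fun v => ⟨τ v, hτ v⟩
  have hb (c : S → k) : ((∑ v, c v • b v : torsion k K) : KInfty k K) = ∑ v, c v • τ v := by
    simp [b]
  have hli : LinearIndependent k b := by
    rw [Fintype.linearIndependent_iff]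
    intro c hc v
    have h0 := hnorm c
    rw [← hb, hc, Submodule.coe_zero, zero_sub, norm_neg] at h0
    by_contra hcv
    have h1 := sub_mem (mem_smallAt_of_le_one (val_lt_one_of_norm_lt_one (v := v.1) h0).le)
      (hcomb c v)
    rw [sub_sub_cancel, mem_smallAt, val_const_smul hcv, (val_pow_lt_of_val_add_lt (hρ v)).1] at h1
    exact lt_irrefl _ h1
  have hspan : ⊤ ≤ Submodule.span k (Set.range b) := by
    rintro ⟨σ, hσ⟩ -
    obtain ⟨y, hy⟩ := exists_norm_sub_ofK_lt σ one_pos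
    have hy' := val_lt_of_mem_torsion hσ (x := y) (by rwa [norm_sub_rev])
    choose c hc using fun v : S => exists_sub_smul_mem_smallAt (hρ v) (hy' v)
    have h0 : σ - ∑ v, c v • τ v = 0 := by
      refine eq_zero_of_mem_torsion
        (sub_mem hσ (sum_mem fun v _ => Submodule.smul_mem _ _ (hτ v)))
        (x := y - ∑ v, algebraMap k (RatFunc k) (c v) • x v) ?_ fun v => ?_
      · rw [map_sub, sub_sub_sub_comm]
        exact (norm_sub_le_max_of_isUltrametricDist _ _).trans_lt (max_lt hy (hnorm c))
      · by_cases hv : v.HasRoot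
        · have := sub_mem (hc ⟨v, hv⟩) (hcomb c ⟨v, hv⟩)
          rwa [sub_sub_sub_cancel_right] at this
        · refine sub_mem ?_ (sum_mem fun w _ => const_smul_mem_smallAt _ (hx' w v ?_))
          · by_contra hcon
            exact hv (hasRoot_iff.mpr ⟨y, val_pow_add_lt_of_notMem_smallAt (hy' v) hcon⟩)
          · rintro rfl
            exact hv w.2
    rw [sub_eq_zero] at h0
    have h1 : (⟨σ, hσ⟩ : torsion k K) = ∑ v, c v • b v := Subtype.ext (h0.trans (hb c).symm)
    rw [h1]
    exact sum_mem fun v _ => Submodule.smul_mem _ _ (Submodule.subset_span ⟨v, rfl⟩)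
  have h := rank_eq_card_basis (Module.Basis.mk hli hspan)
  rwa [← Nat.card_eq_fintype_card] at h

end TorsionPlaces

/-! ### The rank of `U_R` -/

section Rank

open PlaceAboveInfty

variable (k : Type*) [Field k] [Fintype k] (K : Type*) [Field K] [Algebra (RatFunc k) K]

theorem hasRoot_of_card_eq_two (hq : Fintype.card k = 2) (v : PlaceAboveInfty k K) : v.HasRoot :=
  ⟨-((algebraMap (RatFunc k) K RatFunc.X : K) : v.Completion), by rw [hq, pow_one]⟩

/-- The values of `k(t)` at a place above `∞` are the powers of the value of `t`, so a
`(q - 1)`-st root of `-t` cannot exist if `q - 1 > 1`. -/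
theorem not_hasRoot_ratFunc (hq : 2 < Fintype.card k) (v : PlaceAboveInfty k (RatFunc k)) :
    ¬ v.HasRoot := by
  intro h
  obtain ⟨x, hx⟩ := hasRoot_iff.mp h
  have h1 := (val_pow_lt_of_val_add_lt hx).1
  have hx0 : x ≠ 0 := by
    rintro rfl
    rw [map_zero, zero_pow (by lia)] at h1
    exact (zero_lt_one.trans v.one_lt_val_t).ne h1
  have h2 : v.val x = v.val (tElt k (RatFunc k)) ^ x.intDegree := v.val_ratFunc hx0
  rw [h2, ← zpow_natCast, ← zpow_mul] at h1
  have h3 := (zpow_right_injective₀ (zero_lt_one.trans v.one_lt_val_t) v.one_lt_val_t.ne')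
    (h1.trans (zpow_one _).symm)
  rw [mul_comm, Nat.cast_sub (by lia), Int.mul_eq_one_iff_eq_one_or_neg_one] at h3
  lia

omit [Fintype k] in
theorem nonempty_placeAboveInfty_ratFunc : Nonempty (PlaceAboveInfty k (RatFunc k)) := by
  classical
  refine ⟨⟨(RatFunc.inftyValuation k).valuationSubring, fun h => ?_⟩⟩
  rw [Valuation.mem_valuationSubring_iff, Algebra.algebraMap_self_apply,
    RatFunc.inftyValuation.X] at h
  exact absurd h (by decide)

variable [Algebra k K] [Algebra k[X] K] [IsScalarTower k k[X] K] [IsScalarTower k[X] (RatFunc k) K]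
  [FunctionField k K]

theorem rank_carlitzUnits_add_card_hasRoot : Module.rank k[X] (carlitzUnits k K) +
    Cardinal.mk {v : PlaceAboveInfty k K // v.HasRoot} =
      (Module.finrank (RatFunc k) K : Cardinal) := by
  have := finite_periodLattice k K
  have h1 := rank_torsion (k := k) (K := K)
  rw [rank_torsion_eq_card_hasRoot k K, Nat.cast_inj] at h1
  have h2 := rank_carlitzUnits_add_finrank_periodLattice (k := k) (K := K)
  rw [← h1] at h2
  rwa [← Nat.cast_card]

end Rank

end

end CarlitzUnits

theorem mainTheorem4 (k : Type*) [Field k] [Fintype k] (K : Type*) [Field K] [Algebra k K]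
    [Algebra k[X] K] [Algebra (RatFunc k) K] [IsScalarTower k k[X] K]
    [IsScalarTower k[X] (RatFunc k) K] [FunctionField k K] :
    Module.rank k[X] (CarlitzUnits.carlitzUnits k K) +
        Cardinal.mk {v : CarlitzUnits.PlaceAboveInfty k K // v.HasRoot} =
      (Module.finrank (RatFunc k) K : Cardinal) ∧
    (Algebra.IsSeparable (RatFunc k) K →
      Module.rank k[X] (CarlitzUnits.carlitzUnits k K) +
          Cardinal.mk {v : CarlitzUnits.PlaceAboveInfty k K // v.HasRoot} =
        (Field.finSepDegree (RatFunc k) K : Cardinal)) ∧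
    (2 < Fintype.card k → Module.rank k[X] (CarlitzUnits.carlitzUnits k (RatFunc k)) = 1) ∧
    (Fintype.card k = 2 → Module.rank k[X] (CarlitzUnits.carlitzUnits k (RatFunc k)) = 0) := by
  have h := CarlitzUnits.rank_carlitzUnits_add_card_hasRoot k K
  have h1 := CarlitzUnits.rank_carlitzUnits_add_card_hasRoot k (RatFunc k)
  rw [Module.finrank_self, Nat.cast_one] at h1
  refine ⟨h, fun hsep => ?_, fun hq => ?_, fun hq => ?_⟩
  · rw [h, Field.finSepDegree_eq_finrank_of_isSeparable]
  · have : IsEmpty {v : CarlitzUnits.PlaceAboveInfty k (RatFunc k) // v.HasRoot} :=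
      ⟨fun v => CarlitzUnits.not_hasRoot_ratFunc k hq v.1 v.2⟩
    rwa [Cardinal.mk_eq_zero, add_zero] at h1
  · obtain ⟨v⟩ := CarlitzUnits.nonempty_placeAboveInfty_ratFunc k
    have : Nonempty {v : CarlitzUnits.PlaceAboveInfty k (RatFunc k) // v.HasRoot} :=
      ⟨⟨v, CarlitzUnits.hasRoot_of_card_eq_two k (RatFunc k) hq v⟩⟩
    have h2 : (1 : Cardinal) ≤
        Cardinal.mk {v : CarlitzUnits.PlaceAboveInfty k (RatFunc k) // v.HasRoot} :=
      Cardinal.one_le_iff_ne_zero.mpr (Cardinal.mk_ne_zero _)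
    by_contra h3
    have h4 := add_le_add (Cardinal.one_le_iff_ne_zero.mpr h3) h2
    rw [h1] at h4
    exact absurd h4 (by norm_num)
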